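/- **Theorem.** Let $n\ge 1$; all indices below are taken modulo $n$. There is a bijection between non-degenerate dancing pairs of closed $n$-gons in $\mathbb{RP}^2$ and generic pairs $([\Gamma],q)$, where $q\in S^3$ and $[\Gamma]$ is an equivalence class of non-degenerate closed spherical $n$-gons with trivial lifted rolling monodromy for $\rho=3$; it is realised by the diagram $Q^{dan}\xrightarrow{\iota}Q^{oct}\xleftarrow{\phi}S^2\times S^3$, as explained below. (Triviality of the monodromy, and genericity, do not depend on the representative $\Gamma$ of $[\Gamma]$.) *Dancing pairs.* A pair of closed $n$-gons is given by the vertices $A_1,\dots,A_n\in\mathbb{RP}^2$ of the first polygon and the edges (lines) $b_1,\dots,b_n\in(\mathbb{RP}^2)^*$ of the second one. Put $a_i=A_iA_{i+1}$ (line) and $B_i=b_i\cap b_{i+1}$ (point). The pair is *inscribed* if $B_i\in a_i$ for all $i$; it is *non-degenerate* if for all $i$: $A_i\notin b_i$, the points $A_i,A_{i+1},A_{i+2}$ are not collinear, and the lines $b_i,b_{i+1},b_{i+2}$ are not concurrent. An inscribed pair is *dancing* if for all $i$ $$[A_{i+1},B_i,A_i,D]+[A_{i+1},B_{i+1},A_{i+2},C]=0,\qquad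 C=b_i\cap a_{i+1},\quad D=a_i\cap b_{i+2},$$ where the cross-ratio of four collinear points with affine coordinates $x_1,\dots,x_4$ on their line is $\frac{(x_1-x_3)(x_2-x_4)}{(x_1-x_4)(x_2-x_3)}$. *Spherical polygons and rolling.* A closed spherical $n$-gon $\Gamma$ consists of vertices $v_1,\dots,v_n\in S^2$ and, for each $i$, a directed arc of a great circle (of positive length, possibly wrapping around the circle) from $v_i$ to $v_{i+1}$. It is *non-degenerate* if no three consecutive vertices lie on a great circle. Two of them, with vertices $v_i$ and $v_i'$, are *equivalent* if $v_i'=\pm v_i$ for every $i$ (the signs may depend on $i$). A path $(v(t),g(t))$ in $S^2\times SO_3$ is a *rolling motion* for the radius ratio $\rho$ if $(\rho+1)\dot v=\omega\times v$ and $\omega\cdot v=0$, where $\omega$ is the angular velocity, $\dot g g^{-1}=\omega\times\cdot$. Let $S^3$ be the group of unit quaternions, with the double cover $S^3\to SO_3$, $q\mapsto(x\mapsto qx\bar q)$, where $\mathbb R^3=\operatorname{Im}\mathbb H$. For $q\in S^3$, rolling once along $\Gamma$ and lifting continuously to $S^3$ gives the *horizontal lift* of $\Gamma$ to $S^2\times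 S^3$ starting at $(v_1,q)$, with successive vertices $(v_1,q_1),(v_2,q_2),\dots,(v_n,q_n),(v_{1},q_{n+1})$, $q_1=q$. The *lifted rolling monodromy* is $q_{n+1}$ for $q=1$; it is trivial if it equals $1$. *The diagram.* Let $Q^{dan}=\{(\mathbf A,\mathbf b)\in\mathbb R^3\times(\mathbb R^3)^*: \mathbf b\mathbf A=1\}$. An affine line is *horizontal* if it is contained in $Q^{dan}$ and at each of its points $(\mathbf A,\mathbf b)$ its direction $(\dot{\mathbf A},\dot{\mathbf b})$ satisfies $\dot{\mathbf b}=\mathbf A\times\dot{\mathbf A}$. A closed *horizontal polygon* in $Q^{dan}$ is one whose edges are horizontal lines; it is non-degenerate if no three consecutive vertices are collinear. Let $Q^{oct}$ be the projectivised null cone of the quadratic form $-x^2+\mathbf b\mathbf A$ on the imaginary split octonions $\left(\begin{smallmatrix}x&\mathbf A\\ \mathbf b&-x\end{smallmatrix}\right)$, and let $$\iota(\mathbf A,\mathbf b)=\left[\begin{pmatrix}1&\mathbf A\\ \mathbf b&-1\end{pmatrix}\right],\qquad \phi(v,q)=\left[\begin{pmatrix}\operatorname{Re}(vq)& v+\operatorname{Im}(vq)\\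 v-\operatorname{Im}(vq)&-\operatorname{Re}(vq)\end{pmatrix}\right].$$ A pair $(\Gamma,q)$ is *generic* if for $\rho=3$ all vertices $(v_i,q_i)$, $1\le i\le n$, of the horizontal lift of $\Gamma$ starting at $(v_1,q)$ satisfy $\phi(v_i,q_i)\in\iota(Q^{dan})$; $([\Gamma],q)$ is generic if $(\Gamma,q)$ is. *The bijection.* A non-degenerate dancing pair $(A_i,b_i)$ corresponds to $([\Gamma],q)$, $\Gamma$ a non-degenerate closed spherical $n$-gon, if and only if there is a non-degenerate closed horizontal polygon in $Q^{dan}$ with vertices $(\mathbf A_i,\mathbf b_i)$ such that $A_i=[\mathbf A_i]$, $b_i=[\mathbf b_i]$ and, for $\rho=3$, $\iota(\mathbf A_i,\mathbf b_i)=\phi(v_i,q_i)$ for all $i$, where $(v_i,q_i)$ are the vertices of the horizontal lift of $\Gamma$ starting at $(v_1,q)$. -/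

import Mathlib

open scoped Quaternion Matrix LinearAlgebra.Projectivization

noncomputable section

namespace Dancing

/-! ### The projective plane, inscribed and dancing pairs of closed polygons -/

/-- Vectors of `ℝ³`. Row vectors are identified with column vectors by the standard inner
product, so that `Vec3` is also used for `(ℝ³)^*`. -/
abbrev Vec3 := Fin 3 → ℝ

/-- Points of the real projective plane. -/
abbrev RP2 := ℙ ℝ Vec3

/-- Lines of the real projective plane, given by the class of the row vector of their
coefficients. -/
abbrev RP2Line := ℙ ℝ Vec3

/-- The point `A` lies on the line `b`. -/
def Incident (A : RP2) (b : RP2Line) : Prop := Projectivization.orthogonal b A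

/-- The line through two points (which are meant to be distinct). -/
def join (A A' : RP2) : RP2Line := Projectivization.cross A A'

/-- The intersection point of two lines (which are meant to be distinct). -/
def meet (b b' : RP2Line) : RP2 := Projectivization.cross b b'

/-- `x` is the coordinate of the point `P` in the affine coordinate `x ↦ [u + x w]` on the
line through `[u]` and `[w]`. -/
def HasAffineCoord (u w : Vec3) (P : RP2) (x : ℝ) : Prop :=
  ∃ h : u + x • w ≠ 0, P = Projectivization.mk ℝ (u + x • w) h

/-- The four collinear points `P₁, P₂, P₃, P₄` have a (finite) cross-ratio, and it is `r`: for
some affine coordinate along a line that contains them,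
`r = (x₁ - x₃)(x₂ - x₄) / ((x₁ - x₄)(x₂ - x₃))`, with a non-zero denominator. -/
def HasCrossRatio (P₁ P₂ P₃ P₄ : RP2) (r : ℝ) : Prop :=
  ∃ u w : Vec3, LinearIndependent ℝ ![u, w] ∧
    ∃ x₁ x₂ x₃ x₄ : ℝ, HasAffineCoord u w P₁ x₁ ∧ HasAffineCoord u w P₂ x₂ ∧
      HasAffineCoord u w P₃ x₃ ∧ HasAffineCoord u w P₄ x₄ ∧
      (x₁ - x₄) * (x₂ - x₃) ≠ 0 ∧
      r = ((x₁ - x₃) * (x₂ - x₄)) / ((x₁ - x₄) * (x₂ - x₃))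

/-- A pair of closed `n`-gons in `ℝP²`: the first is given by its vertices `A i`, the second by
its edges `b i`. Indices are taken modulo `n`. -/
structure PolygonPair (n : ℕ) where
  A : ZMod n → RP2
  b : ZMod n → RP2Line

namespace PolygonPair

variable {n : ℕ}

/-- The edge `a i` of the first polygon. -/
def a (P : PolygonPair n) (i : ZMod n) : RP2Line := join (P.A i) (P.A (i + 1))

/-- The vertex `B i` of the second polygon. -/
def B (P : PolygonPair n) (i : ZMod n) : RP2 := meet (P.b i) (P.b (i + 1))

/-- The second polygon is inscribed in the first. -/
def Inscribed (P : PolygonPair n) : Prop := ∀ i, Incident (P.B i) (P.a i)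

/-- Non-degeneracy of a pair of polygons. -/
def NonDegenerate (P : PolygonPair n) : Prop :=
  (∀ i, ¬ Incident (P.A i) (P.b i)) ∧
  (∀ i, Projectivization.Independent ![P.A i, P.A (i + 1), P.A (i + 2)]) ∧
  (∀ i, Projectivization.Independent ![P.b i, P.b (i + 1), P.b (i + 2)])

/-- The dancing condition
`[A (i+1), B i, A i, D] + [A (i+1), B (i+1), A (i+2), C] = 0` for all `i`, where
`C` is the intersection of `b i` with `a (i+1)` and `D` that of `a i` with `b (i+2)`. -/
def DancingCondition (P : PolygonPair n) : Prop :=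
  ∀ i, ∃ r s : ℝ,
    HasCrossRatio (P.A (i + 1)) (P.B i) (P.A i) (meet (P.a i) (P.b (i + 2))) r ∧
    HasCrossRatio (P.A (i + 1)) (P.B (i + 1)) (P.A (i + 2)) (meet (P.b i) (P.a (i + 1))) s ∧
    r + s = 0

end PolygonPair

/-- The non-degenerate dancing pairs of closed `n`-gons. -/
def DancingPair (n : ℕ) : Type :=
  {P : PolygonPair n // P.Inscribed ∧ P.NonDegenerate ∧ P.DancingCondition}

/-! ### Spherical polygons and rolling balls -/

/-- The unit sphere in `ℝ³`. -/
abbrev S2 := {v : Vec3 // v ⬝ᵥ v = 1}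

/-- The unit quaternions. -/
abbrev S3 := Metric.sphere (0 : ℍ[ℝ]) 1

/-- The rotation group of `ℝ³`. -/
abbrev SO3 := Matrix.specialOrthogonalGroup (Fin 3) ℝ

/-- The imaginary quaternion of a vector. -/
def imQ (v : Vec3) : ℍ[ℝ] := ⟨0, v 0, v 1, v 2⟩

@[simp] theorem imQ_re (v : Vec3) : (imQ v).re = 0 := rfl
@[simp] theorem imQ_imI (v : Vec3) : (imQ v).imI = v 0 := rfl
@[simp] theorem imQ_imJ (v : Vec3) : (imQ v).imJ = v 1 := rfl
@[simp] theorem imQ_imK (v : Vec3) : (imQ v).imK = v 2 := rfl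

/-- The vector of the imaginary part of a quaternion. -/
def vecIm (q : ℍ[ℝ]) : Vec3 := ![q.imI, q.imJ, q.imK]

/-- The linear map `x ↦ q x q̄` of `ℝ³ = Im ℍ`. -/
def conjLin (q : ℍ[ℝ]) : Vec3 →ₗ[ℝ] Vec3 where
  toFun x := vecIm (q * imQ x * star q)
  map_add' x y := by
    ext i
    fin_cases i <;> simp [vecIm] <;> ring
  map_smul' c x := by
    ext i
    fin_cases i <;> simp [vecIm] <;> ring

theorem S3.sq_sum (q : S3) :
    (q : ℍ[ℝ]).re ^ 2 + (q : ℍ[ℝ]).imI ^ 2 + (q : ℍ[ℝ]).imJ ^ 2 + (q : ℍ[ℝ]).imK ^ 2 = 1 := by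
  have h : ‖(q : ℍ[ℝ])‖ = 1 := by simp
  rw [← Quaternion.normSq_def', Quaternion.normSq_eq_norm_mul_self, h, one_mul]

/-- The double cover `S³ → SO₃`, `q ↦ (x ↦ q x q̄)`. -/
def Ad (q : S3) : SO3 :=
  ⟨LinearMap.toMatrix' (conjLin q), by
    have h := S3.sq_sum q
    set a := (q : ℍ[ℝ]).re
    set b := (q : ℍ[ℝ]).imI
    set c := (q : ℍ[ℝ]).imJ
    set d := (q : ℍ[ℝ]).imK
    rw [Matrix.mem_specialOrthogonalGroup_iff, Matrix.mem_orthogonalGroup_iff]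
    constructor
    · ext i j
      fin_cases i <;> fin_cases j <;>
        simp [Matrix.mul_apply, Fin.sum_univ_three, LinearMap.toMatrix'_apply, conjLin, vecIm]
      all_goals first
        | linear_combination (a ^ 2 + b ^ 2 + c ^ 2 + d ^ 2 + 1) * h
        | ring
    · rw [Matrix.det_fin_three]
      simp [LinearMap.toMatrix'_apply, conjLin, vecIm]
      linear_combination ((a ^ 2 + b ^ 2 + c ^ 2 + d ^ 2) ^ 2 +
        (a ^ 2 + b ^ 2 + c ^ 2 + d ^ 2) + 1) * h⟩

/-- The rolling distribution for the radius ratio `ρ`, on `S² × SO₃`: at `(v, g)` it consists of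
the tangent vectors `(v', g')` such that the angular velocity `ω` of `g'`, defined by
`g' g⁻¹ = ω × ·`, satisfies `(ρ + 1) v' = ω × v` (no slip) and `ω · v = 0` (no twist). -/
def rollDistribution (ρ : ℝ) (v : S2) (g : SO3) : Set (Vec3 × Matrix (Fin 3) (Fin 3) ℝ) :=
  {X | v.1 ⬝ᵥ X.1 = 0 ∧ ∃ ω : Vec3, (∀ x : Vec3, X.2 *ᵥ x = ω ⨯₃ (g.1 *ᵥ x)) ∧
    (ρ + 1) • X.1 = ω ⨯₃ v.1 ∧ ω ⬝ᵥ v.1 = 0}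

/-- `t ↦ (γ t, g t)`, `0 ≤ t ≤ ℓ`, is a motion of the moving ball along `γ` without slipping or
twisting. -/
def IsRolling (ρ ℓ : ℝ) (γ : ℝ → S2) (g : ℝ → SO3) : Prop :=
  ∀ t ∈ Set.Icc 0 ℓ, ∃ X ∈ rollDistribution ρ (γ t) (g t),
    HasDerivWithinAt (fun s => (γ s).1) X.1 (Set.Icc 0 ℓ) t ∧
    ∀ x : Vec3, HasDerivWithinAt (fun s => (g s).1 *ᵥ x) (X.2 *ᵥ x) (Set.Icc 0 ℓ) t

/-- `q` is a continuous lift to `S³` of the rotation part of a rolling motion along `γ`, i.e.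
`(γ, q)` is a horizontal path of the distribution pulled back to `S² × S³`. -/
def IsLiftedRolling (ρ ℓ : ℝ) (γ : ℝ → S2) (q : ℝ → S3) : Prop :=
  ContinuousOn q (Set.Icc 0 ℓ) ∧ IsRolling ρ ℓ γ (fun t => Ad (q t))

/-- A closed spherical `n`-gon: its vertices `v i`, and for each `i` an edge, which is a directed
arc of a great circle from `v i` to `v (i+1)`, with unit initial direction `dir i` and length
`len i > 0`. An edge may wrap around its great circle. -/
structure SphericalPolygon (n : ℕ) where
  v : ZMod n → S2
  dir : ZMod n → S2
  len : ZMod n → ℝ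
  dir_perp : ∀ i, (v i).1 ⬝ᵥ (dir i).1 = 0
  len_pos : ∀ i, 0 < len i
  end_eq : ∀ i, Real.cos (len i) • (v i).1 + Real.sin (len i) • (dir i).1 = (v (i + 1)).1

namespace SphericalPolygon

variable {n : ℕ}

/-- The `i`-th edge, parametrised by arc length. -/
def edge (Γ : SphericalPolygon n) (i : ZMod n) (t : ℝ) : S2 :=
  ⟨Real.cos t • (Γ.v i).1 + Real.sin t • (Γ.dir i).1, by
    have h1 := (Γ.v i).2
    have h2 := (Γ.dir i).2
    have h3 := Γ.dir_perp i
    have h4 : (Γ.dir i).1 ⬝ᵥ (Γ.v i).1 = 0 := by rw [dotProduct_comm]; exact h3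
    simp only [add_dotProduct, dotProduct_add, smul_dotProduct, dotProduct_smul, h1, h2, h3, h4,
      smul_eq_mul]
    nlinarith [Real.sin_sq_add_cos_sq t]⟩

/-- No three consecutive vertices lie on a great circle. -/
def NonDegenerate (Γ : SphericalPolygon n) : Prop :=
  ∀ i, LinearIndependent ℝ ![(Γ.v i).1, (Γ.v (i + 1)).1, (Γ.v (i + 2)).1]

/-- Rolling along the `i`-th edge carries the lifted orientation `q` to `q'`. -/
def RollsTo (ρ : ℝ) (Γ : SphericalPolygon n) (i : ZMod n) (q q' : S3) : Prop :=
  ∃ p : ℝ → S3, IsLiftedRolling ρ (Γ.len i) (Γ.edge i) p ∧ p 0 = q ∧ p (Γ.len i) = q'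

/-- The points `(v k, Q k)`, `k = 0, 1, 2, …`, are the successive vertices of the horizontal lift
of `Γ` to `S² × S³` that starts at `(v 0, q)`; after `n` steps `Γ` has been traversed once. -/
def IsHorizontalLift (ρ : ℝ) (Γ : SphericalPolygon n) (q : S3) (Q : ℕ → S3) : Prop :=
  Q 0 = q ∧ ∀ k : ℕ, Γ.RollsTo ρ (k : ZMod n) (Q k) (Q (k + 1))

/-- `μ` is the lifted rolling monodromy of `Γ`: the end point of the lifted path that starts at
`1 ∈ S³` as the ball rolls once along `Γ`. -/
def IsLiftedMonodromy (ρ : ℝ) (Γ : SphericalPolygon n) (μ : S3) : Prop :=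
  ∃ Q : ℕ → S3, Γ.IsHorizontalLift ρ 1 Q ∧ Q n = μ

/-- The lifted rolling monodromy is trivial. -/
def TrivialLiftedMonodromy (ρ : ℝ) (Γ : SphericalPolygon n) : Prop := Γ.IsLiftedMonodromy ρ 1

end SphericalPolygon

/-- The non-degenerate closed spherical `n`-gons. -/
def NDSphericalPolygon (n : ℕ) : Type := {Γ : SphericalPolygon n // Γ.NonDegenerate}

/-- Two polygons are equivalent if they have the same vertices, some of which may be replaced by
their antipodes. -/
instance polygonSetoid (n : ℕ) : Setoid (NDSphericalPolygon n) where
  r Γ Γ' := ∀ i, (Γ'.1.v i).1 = (Γ.1.v i).1 ∨ (Γ'.1.v i).1 = -(Γ.1.v i).1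
  iseqv :=
    { refl := fun _ _ => Or.inl rfl
      symm := by
        intro Γ Γ' h i
        rcases h i with h | h
        · exact Or.inl h.symm
        · exact Or.inr (by rw [h, neg_neg])
      trans := by
        intro Γ Γ' Γ'' h h' i
        rcases h i with h | h <;> rcases h' i with h' | h' <;> rw [h', h] <;> simp }

/-- The equivalence classes `[Γ]` of non-degenerate closed spherical `n`-gons. -/
abbrev PolygonClass (n : ℕ) : Type := Quotient (polygonSetoid n)

/-! ### The three models and the maps between them -/

/-- The affine quadric `{(A, b) | b A = 1}` in `ℝ³ × (ℝ³)^*`. -/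
def Qdan : Set (Vec3 × Vec3) := {p | p.2 ⬝ᵥ p.1 = 1}

/-- The rank 2 distribution on `Qdan`: `b' A + b A' = 0`, `b' = A × A'`. -/
def danDistribution (p : Vec3 × Vec3) : Set (Vec3 × Vec3) :=
  {X | X.2 ⬝ᵥ p.1 + p.2 ⬝ᵥ X.1 = 0 ∧ X.2 = p.1 ⨯₃ X.1}

/-- The affine line through the distinct points `p, p'` is contained in `Qdan` and everywhere
tangent to the distribution. -/
def IsHorizontalLine (p p' : Vec3 × Vec3) : Prop :=
  p ≠ p' ∧ ∀ t : ℝ, AffineMap.lineMap p p' t ∈ Qdan ∧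
    p' - p ∈ danDistribution (AffineMap.lineMap p p' t)

/-- The points `R i` are the vertices of a non-degenerate closed horizontal `n`-gon in `Qdan`. -/
def IsHorizontalPolygon {n : ℕ} (R : ZMod n → Qdan) : Prop :=
  (∀ i, IsHorizontalLine (R i).1 (R (i + 1)).1) ∧
  ∀ i, ¬ Collinear ℝ {(R i).1, (R (i + 1)).1, (R (i + 2)).1}

/-- `R` is a lift of the pair of polygons `P`: its vertices `(𝐀 i, 𝐛 i)` satisfy
`A i = [𝐀 i]` and `b i = [𝐛 i]`. -/
def LiftsPair {n : ℕ} (R : ZMod n → Qdan) (P : PolygonPair n) : Prop :=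
  ∀ i, (∃ h : (R i).1.1 ≠ 0, P.A i = Projectivization.mk ℝ (R i).1.1 h) ∧
    ∃ h : (R i).1.2 ≠ 0, P.b i = Projectivization.mk ℝ (R i).1.2 h

/-- Imaginary split octonions; `(x, A, b)` stands for the vector matrix with rows `(x, A)` and
`(b, -x)`. -/
abbrev ImOct := ℝ × Vec3 × Vec3

/-- The quadratic form `⟨ζ, ζ⟩ = - x² + b A` of the split octonions, on imaginary ones. -/
def octForm (ζ : ImOct) : ℝ := -ζ.1 ^ 2 + ζ.2.2 ⬝ᵥ ζ.2.1

/-- The projectivised null cone of the imaginary split octonions. -/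
def Qoct : Set (ℙ ℝ ImOct) := {p | ∃ (ζ : ImOct) (h : ζ ≠ 0), p = Projectivization.mk ℝ ζ h ∧
  octForm ζ = 0}

/-- The embedding of `Qdan` in `Qoct`, `(A, b) ↦ [(1, A), (b, -1)]`. -/
def iota (p : Qdan) : Qoct :=
  ⟨Projectivization.mk ℝ ((1, p.1.1, p.1.2) : ImOct) (by simp [Prod.ext_iff]),
    _, _, rfl, by
      have h : p.1.2 ⬝ᵥ p.1.1 = 1 := p.2
      simp [octForm, h]⟩

/-- The vector matrix with rows `(Re(vq), v + Im(vq))` and `(v - Im(vq), -Re(vq))`. -/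
def phiMatrix (v : S2) (q : S3) : ImOct :=
  ((imQ v.1 * (q : ℍ[ℝ])).re, v.1 + vecIm (imQ v.1 * (q : ℍ[ℝ])),
    v.1 - vecIm (imQ v.1 * (q : ℍ[ℝ])))

theorem phiMatrix_ne_zero (v : S2) (q : S3) : phiMatrix v q ≠ 0 := by
  intro h
  have h1 : v.1 + vecIm (imQ v.1 * (q : ℍ[ℝ])) = 0 := congrArg (fun z : ImOct => z.2.1) h
  have h2 : v.1 - vecIm (imQ v.1 * (q : ℍ[ℝ])) = 0 := congrArg (fun z : ImOct => z.2.2) h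
  have h3 : v.1 = 0 := by
    ext i
    have e1 := congrFun h1 i
    have e2 := congrFun h2 i
    simp only [Pi.add_apply, Pi.sub_apply, Pi.zero_apply] at e1 e2 ⊢
    linarith
  have h4 := v.2
  simp [h3] at h4

theorem octForm_phiMatrix (v : S2) (q : S3) : octForm (phiMatrix v q) = 0 := by
  have hq := S3.sq_sum q
  simp [octForm, phiMatrix, vecIm, dotProduct, Fin.sum_univ_three, Matrix.vecHead, Matrix.vecTail]
  linear_combination (-(v.1 0 ^ 2 + v.1 1 ^ 2 + v.1 2 ^ 2)) * hq

/-- The composition of `Φ : S² × S³ → (null cone) / ℝ⁺` with the double cover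
`(null cone) / ℝ⁺ → Qoct`. -/
def phi (v : S2) (q : S3) : Qoct :=
  ⟨Projectivization.mk ℝ (phiMatrix v q) (phiMatrix_ne_zero v q),
    _, _, rfl, octForm_phiMatrix v q⟩

/-! ### Generic pairs and the correspondence -/

/-- All the vertices of the horizontal lift of `Γ` that starts at `(v 0, q)`, for `ρ = 3`, are
sent by `phi` into the image of `iota`. -/
def IsGeneric {n : ℕ} (Γ : SphericalPolygon n) (q : S3) : Prop :=
  ∃ Q : ℕ → S3, Γ.IsHorizontalLift 3 q Q ∧
    ∀ k < n, phi (Γ.v (k : ZMod n)) (Q k) ∈ Set.range iota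

/-- The generic pairs `([Γ], q)`, where `[Γ]` is an equivalence class of non-degenerate closed
spherical `n`-gons with trivial lifted rolling monodromy for `ρ = 3` and `q ∈ S³`. -/
def GenericPair (n : ℕ) : Type :=
  {x : PolygonClass n × S3 // ∃ Γ : NDSphericalPolygon n, ⟦Γ⟧ = x.1 ∧
    Γ.1.TrivialLiftedMonodromy 3 ∧ IsGeneric Γ.1 x.2}

/-- `P` and `(Γ, q)` correspond through the diagram `Qdan → Qoct ← S² × S³`: a non-degenerate
closed horizontal polygon in `Qdan` that lifts `P`, and the horizontal lift of `Γ` that starts at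
`(v 0, q)`, have the same vertices in `Qoct`. -/
def Corresponds {n : ℕ} (P : PolygonPair n) (Γ : SphericalPolygon n) (q : S3) : Prop :=
  ∃ (R : ZMod n → Qdan) (Q : ℕ → S3), IsHorizontalPolygon R ∧ LiftsPair R P ∧
    Γ.IsHorizontalLift 3 q Q ∧ ∀ k < n, iota (R (k : ZMod n)) = phi (Γ.v (k : ZMod n)) (Q k)

end Dancing

end

open Dancing

/-!
Write `x = (𝐀 + 𝐛) / 2` and `y = (𝐀 - 𝐛) / 2` for a point `(𝐀, 𝐛)` of `Qdan`, so that
`|x|² = 1 + |y|²`. It has the same image in `Qoct` as `(v, q)` exactly if `v = s x` and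
`v q = s (1 + y)` for some real `s ≠ 0` (`iota_eq_phi_iff`), so that `(𝐀, 𝐛)` determines `q` and
determines `v` up to sign.

On the spherical side, the angular velocity of a ball rolling with `ρ = 3` along the great circle
`exp (t n) v` is the constant `4 n`, so the lifted motion is `exp (2 t n) q`. As
`exp (t n) = -v' v` at the end `v'` of the arc, rolling along an edge multiplies `q` by `(v' v)²`
(`SphericalPolygon.rollsTo_iff`). This depends neither on the arc nor on the signs of `v` and `v'`.
On the side of `Qdan`, an edge is horizontal exactly if `𝐛' - 𝐛 = 𝐀 × 𝐀'`
(`isHorizontalLine_iff`), which is the quaternionic equation `x' (1 + y) = x (1 + y')`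
(`edge_iff`), and this is again `q' = (v' v)² q` (`edge_iff_rolling`). Hence closed horizontal
polygons in `Qdan` are the same as generic pairs, and the determinants of consecutive triples of
the `v i` and of the `𝐀 i` vanish together (`triple_sum_eq`).

Between dancing pairs and horizontal polygons the argument is projective. For an inscribed pair,
homogeneous coordinates with `b i · A i = 1` can be normalised along one edge so that also
`b i · A (i+1) = b (i+1) · A i = 1`. Then `b (i+1) - b i = μ (A i × A (i+1))` for some `μ ≠ 0`, and
rescaling by the real cube root of `μ` gives the unique horizontal lift of that edge. In
coordinates normalised along two adjacent edges, the two cross-ratios of the dancing condition are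
`1 - b (i+2) · A i` and `1 - b i · A (i+2)`, and their sum vanishes exactly if the two factors `μ`
agree (`dancing_iff`). So the dancing condition says that the lifts of adjacent edges agree at their
common vertex, and the lifted polygon closes up by itself.
-/

namespace Dancing

/-! ### Imaginary quaternions and rotors -/

theorem imQ_add (v w : Vec3) : imQ (v + w) = imQ v + imQ w := by ext <;> simp

theorem imQ_smul (c : ℝ) (v : Vec3) : imQ (c • v) = c • imQ v := by ext <;> simp

theorem imQ_neg (v : Vec3) : imQ (-v) = -imQ v := by ext <;> simp

theorem star_imQ (v : Vec3) : star (imQ v) = -imQ v := by ext <;> simp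

theorem imQ_injective : Function.Injective imQ := by
  intro v w h
  ext i
  fin_cases i
  · exact congrArg QuaternionAlgebra.imI h
  · exact congrArg QuaternionAlgebra.imJ h
  · exact congrArg QuaternionAlgebra.imK h

theorem imQ_vecIm {z : ℍ[ℝ]} (h : z.re = 0) : imQ (vecIm z) = z := by
  ext <;> simp [vecIm, h]

theorem vecIm_imQ (v : Vec3) : vecIm (imQ v) = v := by
  ext i
  fin_cases i <;> simp [vecIm]

/-- The product of imaginary quaternions in terms of the vector products of `ℝ³`. -/
theorem imQ_mul_imQ (v w : Vec3) : imQ v * imQ w = ((-(v ⬝ᵥ w) : ℝ) : ℍ[ℝ]) + imQ (v ⨯₃ w) := by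
  ext <;> simp [cross_apply, dotProduct, Fin.sum_univ_three] <;> ring

theorem imQ_mul_self (v : Vec3) : imQ v * imQ v = ((-(v ⬝ᵥ v) : ℝ) : ℍ[ℝ]) := by
  rw [imQ_mul_imQ, cross_self]
  ext <;> simp

theorem two_smul_imQ_cross (v w : Vec3) :
    (2 : ℝ) • imQ (v ⨯₃ w) = imQ v * imQ w - imQ w * imQ v := by
  rw [imQ_mul_imQ, imQ_mul_imQ, ← cross_anticomm v w, imQ_neg, dotProduct_comm w v, two_smul]
  abel

theorem star_mul_self_of_S3 (q : S3) : star (q : ℍ[ℝ]) * q = 1 := by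
  rw [Quaternion.star_mul_self, Quaternion.normSq_eq_norm_mul_self]
  simp

theorem mul_star_self_of_S3 (q : S3) : (q : ℍ[ℝ]) * star (q : ℍ[ℝ]) = 1 := by
  rw [Quaternion.self_mul_star, Quaternion.normSq_eq_norm_mul_self]
  simp

theorem norm_eq_one_of_star_mul_self {z : ℍ[ℝ]} (h : star z * z = 1) : ‖z‖ = 1 := by
  have h1 : ‖z‖ * ‖z‖ = 1 := by
    rw [← Quaternion.normSq_eq_norm_mul_self]
    rw [Quaternion.star_mul_self] at h
    rwa [← Quaternion.coe_one, Quaternion.coe_inj] at h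
  nlinarith [norm_nonneg z]

theorem Ad_mulVec (q : S3) (x : Vec3) :
    (Ad q).1 *ᵥ x = vecIm ((q : ℍ[ℝ]) * imQ x * star (q : ℍ[ℝ])) :=
  LinearMap.toMatrix'_mulVec _ _

theorem imQ_Ad_mulVec (q : S3) (x : Vec3) :
    imQ ((Ad q).1 *ᵥ x) = (q : ℍ[ℝ]) * imQ x * star (q : ℍ[ℝ]) := by
  rw [Ad_mulVec, imQ_vecIm]
  simp
  ring

/-- `imQ` as a continuous linear map. -/
noncomputable def imQL : Vec3 →L[ℝ] ℍ[ℝ] :=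
  LinearMap.toContinuousLinearMap
    { toFun := imQ, map_add' := imQ_add, map_smul' := imQ_smul }

/-- `vecIm` as a continuous linear map. -/
noncomputable def vecImL : ℍ[ℝ] →L[ℝ] Vec3 :=
  LinearMap.toContinuousLinearMap
    { toFun := vecIm
      map_add' := fun x y => by ext i; fin_cases i <;> simp [vecIm]
      map_smul' := fun c x => by ext i; fin_cases i <;> simp [vecIm] }

theorem imQL_apply (v : Vec3) : imQL v = imQ v := rfl

theorem vecImL_apply (z : ℍ[ℝ]) : vecImL z = vecIm z := rfl

/-- The quaternion `cos t + n sin t`, which is `exp (t n)` when `n ^ 2 = -1`. -/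
noncomputable def rotor (n : ℍ[ℝ]) (t : ℝ) : ℍ[ℝ] :=
  Real.cos t • (1 : ℍ[ℝ]) + Real.sin t • n

theorem rotor_zero (n : ℍ[ℝ]) : rotor n 0 = 1 := by simp [rotor]

theorem rotor_sq {n : ℍ[ℝ]} (hn : n * n = -1) (t : ℝ) : rotor n t ^ 2 = rotor n (2 * t) := by
  rw [sq, rotor, rotor, Real.cos_two_mul', Real.sin_two_mul]
  simp only [add_mul, mul_add, smul_mul_smul_comm, one_mul, mul_one, hn]
  module

theorem star_rotor {n : ℍ[ℝ]} (hs : star n = -n) (t : ℝ) : star (rotor n t) = rotor n (-t) := by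
  simp [rotor, hs]

theorem star_rotor_mul_self {n : ℍ[ℝ]} (hn : n * n = -1) (hs : star n = -n) (t : ℝ) :
    star (rotor n t) * rotor n t = 1 := by
  rw [star_rotor hs, rotor, rotor, Real.cos_neg, Real.sin_neg]
  simp only [add_mul, mul_add, smul_mul_smul_comm, one_mul, mul_one, hn]
  have h2 : (1 : ℍ[ℝ]) = (Real.sin t ^ 2 + Real.cos t ^ 2) • 1 := by
    rw [Real.sin_sq_add_cos_sq, one_smul]
  conv_rhs => rw [h2]
  module

theorem hasDerivAt_rotor {n : ℍ[ℝ]} (hn : n * n = -1) (t : ℝ) :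
    HasDerivAt (rotor n) (n * rotor n t) t := by
  have h2 := ((Real.hasDerivAt_cos t).smul_const (1 : ℍ[ℝ])).add
    ((Real.hasDerivAt_sin t).smul_const n)
  convert! h2 using 1
  simp only [rotor, mul_add, mul_smul_comm, mul_one, hn]
  module

/-! ### Rolling along an arc of a great circle -/

/-- The angular velocity of a rolling motion is determined by the velocity of the contact
point. -/
theorem eq_smul_cross_of_rolling {c : ℝ} {v x ω : Vec3} (hv : v ⬝ᵥ v = 1)
    (h : c • x = ω ⨯₃ v) (hω : ω ⬝ᵥ v = 0) : ω = c • (v ⨯₃ x) := by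
  have h1 : c • (v ⨯₃ x) = v ⨯₃ (ω ⨯₃ v) := by rw [← h, map_smul]
  rw [h1, cross_cross_eq_smul_sub_smul' v ω v, hv, hω]
  simp

/-- A continuous function on an interval with values in `{1, -1}` is constant. -/
theorem eq_one_of_continuousOn_of_eq_one_or {f : ℝ → ℝ} {ℓ : ℝ} (hℓ : 0 ≤ ℓ)
    (hf : ContinuousOn f (Set.Icc 0 ℓ)) (h : ∀ t ∈ Set.Icc 0 ℓ, f t = 1 ∨ f t = -1)
    (h0 : f 0 = 1) : f ℓ = 1 := by
  rcases h ℓ ⟨hℓ, le_rfl⟩ with h1 | h1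
  · exact h1
  · obtain ⟨t, ht, h2⟩ := intermediate_value_Icc' hℓ hf (show (0 : ℝ) ∈ Set.Icc (f ℓ) (f 0) by
      rw [h0, h1]; constructor <;> norm_num)
    rcases h t ht with h3 | h3 <;> rw [h2] at h3 <;> norm_num at h3

/-- A unit quaternion that commutes with all imaginary quaternions is `1` or `-1`. -/
theorem eq_one_or_neg_one_of_commute_imQ {z : ℍ[ℝ]} (h1 : star z * z = 1)
    (h : ∀ x : Vec3, z * imQ x = imQ x * z) : z = (z.re : ℍ[ℝ]) ∧ (z.re = 1 ∨ z.re = -1) := by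
  have e0 := congrArg QuaternionAlgebra.imK (h ![1, 0, 0])
  have e1 := congrArg QuaternionAlgebra.imI (h ![0, 1, 0])
  have e2 := congrArg QuaternionAlgebra.imJ (h ![0, 0, 1])
  simp at e0 e1 e2
  have hI : z.imI = 0 := by linarith
  have hJ : z.imJ = 0 := by linarith
  have hK : z.imK = 0 := by linarith
  refine ⟨by ext <;> simp [hI, hJ, hK], ?_⟩
  have e3 := congrArg QuaternionAlgebra.re h1
  simp [hI, hJ, hK] at e3
  rcases mul_self_eq_one_iff.1 e3 with h | h <;> simp [h]

namespace SphericalPolygon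

variable {n : ℕ} (Γ : SphericalPolygon n) (i : ZMod n)

/-- The unit normal of the `i`-th edge, which is also the imaginary unit `n` for which
`t ↦ exp (t n) v` parametrises the edge. -/
noncomputable def axis : Vec3 := (Γ.v i).1 ⨯₃ (Γ.dir i).1

theorem axis_dot_self : Γ.axis i ⬝ᵥ Γ.axis i = 1 := by
  rw [axis, cross_dot_cross, (Γ.v i).2, (Γ.dir i).2, dotProduct_comm (Γ.dir i).1, Γ.dir_perp]
  norm_num

theorem imQ_axis_mul_self : imQ (Γ.axis i) * imQ (Γ.axis i) = -1 := by
  rw [imQ_mul_self, axis_dot_self]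
  simp

/-- The edge is swept out by the rotor about the axis. -/
theorem imQ_edge (t : ℝ) :
    imQ (Γ.edge i t).1 = rotor (imQ (Γ.axis i)) t * imQ (Γ.v i).1 := by
  have h1 : imQ (Γ.axis i) * imQ (Γ.v i).1 = imQ (Γ.dir i).1 := by
    have h2 : imQ (Γ.axis i) = -(imQ (Γ.dir i).1 * imQ (Γ.v i).1) := by
      rw [imQ_mul_imQ, dotProduct_comm, Γ.dir_perp, axis, ← cross_anticomm (Γ.v i).1, imQ_neg]
      simp
    rw [h2, neg_mul, mul_assoc, imQ_mul_self, (Γ.v i).2]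
    simp
  rw [rotor, add_mul, smul_mul_assoc, smul_mul_assoc, h1, one_mul, edge, imQ_add, imQ_smul,
    imQ_smul]

theorem edge_len : Γ.edge i (Γ.len i) = Γ.v (i + 1) := Subtype.ext (Γ.end_eq i)

theorem rotor_len_sq : rotor (imQ (Γ.axis i)) (2 * Γ.len i) =
    (imQ (Γ.v (i + 1)).1 * imQ (Γ.v i).1) ^ 2 := by
  rw [← edge_len, imQ_edge, mul_assoc, imQ_mul_self, (Γ.v i).2,
    ← rotor_sq (Γ.imQ_axis_mul_self i)]
  simp

/-- The velocity of the edge. -/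
theorem hasDerivAt_edge (t : ℝ) : HasDerivAt (fun s => (Γ.edge i s).1)
    (-Real.sin t • (Γ.v i).1 + Real.cos t • (Γ.dir i).1) t :=
  ((Real.hasDerivAt_cos t).smul_const _).add ((Real.hasDerivAt_sin t).smul_const _)

theorem edge_cross_velocity (t : ℝ) :
    (Γ.edge i t).1 ⨯₃ (-Real.sin t • (Γ.v i).1 + Real.cos t • (Γ.dir i).1) = Γ.axis i := by
  rw [edge]
  simp only [map_add, map_smul, LinearMap.add_apply, LinearMap.smul_apply, cross_self, axis]
  rw [← cross_anticomm (Γ.v i).1 (Γ.dir i).1]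
  have h2 : (Γ.v i).1 ⨯₃ (Γ.dir i).1 =
      (Real.sin t ^ 2 + Real.cos t ^ 2) • ((Γ.v i).1 ⨯₃ (Γ.dir i).1) := by
    rw [Real.sin_sq_add_cos_sq, one_smul]
  conv_rhs => rw [h2]
  module

theorem axis_cross_edge (t : ℝ) : Γ.axis i ⨯₃ (Γ.edge i t).1 =
    -Real.sin t • (Γ.v i).1 + Real.cos t • (Γ.dir i).1 := by
  rw [axis, cross_cross_eq_smul_sub_smul, edge]
  have h1 : (Γ.v i).1 ⬝ᵥ (Γ.v i).1 = 1 := (Γ.v i).2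
  have h2 : (Γ.dir i).1 ⬝ᵥ (Γ.dir i).1 = 1 := (Γ.dir i).2
  have h3 := Γ.dir_perp i
  simp only [dotProduct_add, dotProduct_smul, h1, h2, h3,
    dotProduct_comm (Γ.dir i).1 (Γ.v i).1, smul_eq_mul]
  simp only [mul_one, mul_zero, add_zero, zero_add]
  module

theorem axis_dot_edge (t : ℝ) : Γ.axis i ⬝ᵥ (Γ.edge i t).1 = 0 := by
  rw [axis, edge, dotProduct_add, dotProduct_smul, dotProduct_smul, dotProduct_comm,
    dot_self_cross, dotProduct_comm, dot_cross_self]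
  simp

theorem hasDerivAt_rotor_two_mul {N : ℍ[ℝ]} (hN : N * N = -1) (t : ℝ) :
    HasDerivAt (fun s => rotor N (2 * s)) ((2 : ℝ) • (N * rotor N (2 * t))) t :=
  HasDerivAt.scomp t (hasDerivAt_rotor hN (2 * t)) (by simpa using (hasDerivAt_id t).const_mul 2)

theorem hasDerivAt_star_rotor_two_mul {N : ℍ[ℝ]} (hN : N * N = -1) (hs : star N = -N) (t : ℝ) :
    HasDerivAt (fun s => star (rotor N (2 * s)))
      (-((2 : ℝ) • (star (rotor N (2 * t)) * N))) t := by
  have h1 := HasDerivAt.scomp t (hasDerivAt_rotor hN (-(2 * t)))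
    (show HasDerivAt (fun s : ℝ => -(2 * s)) (-2) t by
      simpa only [neg_mul, id, mul_one] using (hasDerivAt_id t).const_mul (-2))
  have h2 : N * rotor N (-(2 * t)) = rotor N (-(2 * t)) * N := by
    simp only [rotor, mul_add, add_mul, mul_smul_comm, smul_mul_assoc, one_mul, mul_one]
  simp only [star_rotor hs]
  rw [h2, neg_smul] at h1
  exact h1

/-- Uniform rotation about the axis of the edge, at twice its angular speed, lifts to `S³` the
rolling motion along the edge for `ρ = 3`. -/
theorem isLiftedRolling_rotor (q : S3) (p : ℝ → S3)
    (hp : ∀ t, (p t : ℍ[ℝ]) = rotor (imQ (Γ.axis i)) (2 * t) * q) :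
    IsLiftedRolling 3 (Γ.len i) (Γ.edge i) p := by
  have hN := Γ.imQ_axis_mul_self i
  have hd := fun t => hasDerivAt_rotor_two_mul hN t
  have hd' := fun t => hasDerivAt_star_rotor_two_mul hN (star_imQ _) t
  constructor
  · refine Continuous.continuousOn (continuous_induced_rng.2 ?_)
    have h1 : Continuous fun t => rotor (imQ (Γ.axis i)) (2 * t) * q :=
      (continuous_iff_continuousAt.2 fun t => (hd t).continuousAt).mul continuous_const
    exact h1.congr fun t => (hp t).symm
  · intro t _
    set ω : Vec3 := (4 : ℝ) • Γ.axis i with hω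
    have hX (x : Vec3) : LinearMap.toMatrix' (crossProduct ω ∘ₗ Matrix.toLin' (Ad (p t)).1) *ᵥ x =
        ω ⨯₃ ((Ad (p t)).1 *ᵥ x) := by
      rw [LinearMap.toMatrix'_mulVec]
      rfl
    refine ⟨(-Real.sin t • (Γ.v i).1 + Real.cos t • (Γ.dir i).1,
      LinearMap.toMatrix' (crossProduct ω ∘ₗ Matrix.toLin' (Ad (p t)).1)), ⟨?_, ω, hX, ?_, ?_⟩,
      (Γ.hasDerivAt_edge i t).hasDerivWithinAt, fun x => HasDerivAt.hasDerivWithinAt ?_⟩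
    · rw [← axis_cross_edge, dot_cross_self]
    · rw [← axis_cross_edge, hω, map_smul, LinearMap.smul_apply]
      norm_num
    · rw [hω, smul_dotProduct, axis_dot_edge, smul_zero]
    · have h1 := (((hd t).mul_const ((q : ℍ[ℝ]) * imQ x * star (q : ℍ[ℝ]))).mul (hd' t))
      have h2 := vecImL.hasFDerivAt.comp_hasDerivAt t h1
      convert! h2 using 1
      · ext1 s
        simp only [Ad_mulVec, Function.comp_def, vecImL_apply, hp, Pi.mul_apply]
        rw [star_mul]
        simp only [mul_assoc]
      · rw [hX, vecImL_apply]
        apply imQ_injective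
        have h3 : imQ ((Ad (p t)).1 *ᵥ x) = rotor (imQ (Γ.axis i)) (2 * t) *
            ((q : ℍ[ℝ]) * imQ x * star (q : ℍ[ℝ])) * star (rotor (imQ (Γ.axis i)) (2 * t)) := by
          rw [imQ_Ad_mulVec, hp, star_mul]
          simp only [mul_assoc]
        have h4 : imQ (ω ⨯₃ ((Ad (p t)).1 *ᵥ x)) = (2 : ℝ) •
            (imQ (Γ.axis i) * imQ ((Ad (p t)).1 *ᵥ x) -
              imQ ((Ad (p t)).1 *ᵥ x) * imQ (Γ.axis i)) := by
          rw [← two_smul_imQ_cross, hω, map_smul, LinearMap.smul_apply, imQ_smul, smul_smul]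
          norm_num
        have h5 : (2 : ℝ) • (imQ (Γ.axis i) * rotor (imQ (Γ.axis i)) (2 * t)) *
              ((q : ℍ[ℝ]) * imQ x * star (q : ℍ[ℝ])) * star (rotor (imQ (Γ.axis i)) (2 * t)) +
            rotor (imQ (Γ.axis i)) (2 * t) * ((q : ℍ[ℝ]) * imQ x * star (q : ℍ[ℝ])) *
              -((2 : ℝ) • (star (rotor (imQ (Γ.axis i)) (2 * t)) * imQ (Γ.axis i))) =
            imQ (ω ⨯₃ ((Ad (p t)).1 *ᵥ x)) := by
          rw [h4, h3]
          simp only [smul_mul_assoc, mul_smul_comm, mul_neg, mul_assoc, sub_eq_add_neg]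
          rw [smul_add, smul_neg]
        rw [h5, imQ_vecIm]
        rfl

/-- Along any lifted rolling motion, undoing the uniform rotation gives a constant rotation, hence
a constant element of `S³` by continuity. -/
theorem eq_rotor_mul_of_isLiftedRolling (p : ℝ → S3)
    (hp : IsLiftedRolling 3 (Γ.len i) (Γ.edge i) p) :
    (p (Γ.len i) : ℍ[ℝ]) = rotor (imQ (Γ.axis i)) (2 * Γ.len i) * p 0 := by
  obtain ⟨hc, hr⟩ := hp
  set ℓ := Γ.len i
  have hℓ : 0 < ℓ := Γ.len_pos i
  set N := imQ (Γ.axis i) with hNdef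
  have hN : N * N = -1 := Γ.imQ_axis_mul_self i
  have hNs : star N = -N := star_imQ _
  have hd := fun t => hasDerivAt_rotor_two_mul hN t
  have hd' := fun t => hasDerivAt_star_rotor_two_mul hN (star_imQ _) t
  have hu := fun t => star_rotor_mul_self hN hNs (2 * t)
  -- the rotation part of the motion solves `g' = 4 N × g`
  have hg : ∀ t ∈ Set.Icc 0 ℓ, ∀ x : Vec3, HasDerivWithinAt (fun s => (Ad (p s)).1 *ᵥ x)
      (((4 : ℝ) • Γ.axis i) ⨯₃ ((Ad (p t)).1 *ᵥ x)) (Set.Icc 0 ℓ) t := by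
    intro t ht x
    obtain ⟨X, ⟨h1, ω, h2, h3, h4⟩, h5, h6⟩ := hr t ht
    have h7 : X.1 = -Real.sin t • (Γ.v i).1 + Real.cos t • (Γ.dir i).1 :=
      (uniqueDiffOn_Icc hℓ t ht).eq_deriv _ h5 (Γ.hasDerivAt_edge i t).hasDerivWithinAt
    have h8 : ω = (4 : ℝ) • Γ.axis i := by
      rw [eq_smul_cross_of_rolling (Γ.edge i t).2 h3 h4, h7, edge_cross_velocity]
      norm_num
    have h9 := h6 x
    rwa [h2, h8] at h9
  have hconst : ∀ x : Vec3, ∀ t ∈ Set.Icc 0 ℓ,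
      star (rotor N (2 * t)) * imQ ((Ad (p t)).1 *ᵥ x) * rotor N (2 * t) =
        imQ ((Ad (p 0)).1 *ᵥ x) := by
    intro x
    have hD : ∀ t ∈ Set.Icc 0 ℓ, HasDerivWithinAt
        (fun t => star (rotor N (2 * t)) * imQ ((Ad (p t)).1 *ᵥ x) * rotor N (2 * t)) 0
        (Set.Icc 0 ℓ) t := by
      intro t ht
      have h1 := (((hd' t).hasDerivWithinAt (s := Set.Icc 0 ℓ)).mul
        (imQL.hasFDerivAt.comp_hasDerivWithinAt t (hg t ht x))).mul (hd t).hasDerivWithinAt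
      convert! h1 using 1
      set Y := (Ad (p t)).1 *ᵥ x
      have h4 : imQ (((4 : ℝ) • Γ.axis i) ⨯₃ Y) = (2 : ℝ) • (N * imQ Y - imQ Y * N) := by
        rw [← two_smul_imQ_cross, map_smul, LinearMap.smul_apply, imQ_smul, smul_smul]
        norm_num
      simp only [Function.comp_def, imQL_apply, h4]
      simp only [Y, smul_mul_assoc, mul_smul_comm, neg_mul, mul_assoc, smul_sub, mul_sub,
        sub_mul, add_mul, Pi.mul_apply]
      abel
    have h2 := constant_of_derivWithin_zero (fun t ht => (hD t ht).differentiableWithinAt)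
      (fun t ht => (hD t (Set.Ico_subset_Icc_self ht)).derivWithin
        (uniqueDiffOn_Icc hℓ t (Set.Ico_subset_Icc_self ht)))
    intro t ht
    rw [h2 t ht]
    simp [rotor_zero]
  -- `z t = p(0)⁻¹ exp (-2 t N) p(t)` is `1` or `-1`
  set z : ℝ → ℍ[ℝ] := fun t => star (p 0 : ℍ[ℝ]) * star (rotor N (2 * t)) * p t with hz
  have hu' := fun t => mul_eq_one_symm (hu t)
  have hz1 : ∀ t, star (z t) * z t = 1 := by
    intro t
    simp only [hz, star_mul, star_star, mul_assoc]
    rw [← mul_assoc (p 0 : ℍ[ℝ]), mul_star_self_of_S3, one_mul, ← mul_assoc (rotor N (2 * t)),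
      hu', one_mul, star_mul_self_of_S3]
  have hz2 : ∀ t ∈ Set.Icc 0 ℓ, z t = ((z t).re : ℍ[ℝ]) ∧ ((z t).re = 1 ∨ (z t).re = -1) := by
    intro t ht
    apply eq_one_or_neg_one_of_commute_imQ (hz1 t)
    intro x
    have h1 := hconst x t ht
    rw [imQ_Ad_mulVec, imQ_Ad_mulVec] at h1
    have h2 : z t * imQ x * star (z t) = imQ x := by
      have h3 : z t * imQ x * star (z t) = star (p 0 : ℍ[ℝ]) * (star (rotor N (2 * t)) *
          ((p t : ℍ[ℝ]) * imQ x * star (p t : ℍ[ℝ])) * rotor N (2 * t)) * p 0 := by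
        simp only [hz, star_mul, star_star, mul_assoc]
      rw [h3, h1]
      calc _ = (star (p 0 : ℍ[ℝ]) * p 0) * imQ x * (star (p 0 : ℍ[ℝ]) * p 0) := by
            simp only [mul_assoc]
        _ = imQ x := by rw [star_mul_self_of_S3, one_mul, mul_one]
    calc z t * imQ x = z t * imQ x * (star (z t) * z t) := by rw [hz1, mul_one]
      _ = z t * imQ x * star (z t) * z t := by simp only [mul_assoc]
      _ = imQ x * z t := by rw [h2]
  have hzc : ContinuousOn (fun t => (z t).re) (Set.Icc 0 ℓ) := by
    refine Quaternion.continuous_re.comp_continuousOn ?_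
    have h1 : Continuous fun t => star (rotor N (2 * t)) :=
      continuous_iff_continuousAt.2 fun t => (hd' t).continuousAt
    exact (continuous_const.mul h1).continuousOn.mul (continuous_subtype_val.comp_continuousOn hc)
  have hz0 : (z 0).re = 1 := by
    simp only [hz, mul_zero, rotor_zero, star_one, mul_one, star_mul_self_of_S3]
    simp
  have hzℓ := eq_one_of_continuousOn_of_eq_one_or hℓ.le hzc (fun t ht => (hz2 t ht).2) hz0
  have hzℓ' : z ℓ = 1 := by
    rw [(hz2 ℓ ⟨hℓ.le, le_rfl⟩).1, hzℓ]
    simp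
  calc (p ℓ : ℍ[ℝ]) = rotor N (2 * ℓ) * ((p 0 : ℍ[ℝ]) * star (p 0 : ℍ[ℝ])) *
        star (rotor N (2 * ℓ)) * p ℓ := by rw [mul_star_self_of_S3, mul_one, hu', one_mul]
    _ = rotor N (2 * ℓ) * p 0 * z ℓ := by simp only [hz, mul_assoc]
    _ = rotor N (2 * ℓ) * p 0 := by rw [hzℓ', mul_one]

/-- For `ρ = 3`, rolling along an edge multiplies the lifted orientation by the square of the
quaternion `v (i+1) v i`, whichever arc joins the two vertices. -/
theorem rollsTo_iff (q q' : S3) : Γ.RollsTo 3 i q q' ↔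
    (q' : ℍ[ℝ]) = (imQ (Γ.v (i + 1)).1 * imQ (Γ.v i).1) ^ 2 * q := by
  rw [← rotor_len_sq]
  constructor
  · rintro ⟨p, hp, rfl, rfl⟩
    exact Γ.eq_rotor_mul_of_isLiftedRolling i p hp
  · intro h
    have h1 (t : ℝ) : ‖rotor (imQ (Γ.axis i)) (2 * t) * (q : ℍ[ℝ])‖ = 1 := by
      rw [norm_mul, norm_eq_one_of_star_mul_self (star_rotor_mul_self (Γ.imQ_axis_mul_self i)
        (star_imQ _) _), one_mul]
      simp
    refine ⟨fun t => ⟨rotor (imQ (Γ.axis i)) (2 * t) * q, by simpa using h1 t⟩,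
      Γ.isLiftedRolling_rotor i q _ fun t => rfl, ?_, Subtype.ext h.symm⟩
    apply Subtype.ext
    simp [rotor_zero]

end SphericalPolygon

/-! ### Horizontal edges of `Qdan` -/

/-- Between points of `Qdan`, a line is horizontal as soon as `𝐛' - 𝐛 = 𝐀 × 𝐀'`. -/
theorem isHorizontalLine_iff {p p' : Vec3 × Vec3} (hp : p ∈ Qdan) (hp' : p' ∈ Qdan) :
    IsHorizontalLine p p' ↔ p ≠ p' ∧ p'.2 - p.2 = p.1 ⨯₃ p'.1 := by
  obtain ⟨A, b⟩ := p
  obtain ⟨A', b'⟩ := p'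
  have h1 : b ⬝ᵥ A = 1 := hp
  have h2 : b' ⬝ᵥ A' = 1 := hp'
  refine and_congr_right fun _ => ⟨fun h => ?_, fun h t => ?_⟩
  · have h3 := (h 0).2.2
    simpa [cross_self] using h3
  · have e : b' = b + A ⨯₃ A' := by rw [← h]; simp
    subst e
    simp only [add_dotProduct] at h2
    rw [dotProduct_comm (A ⨯₃ A'), dot_cross_self, add_zero] at h2
    have e1 : AffineMap.lineMap (A, b) (A', b + A ⨯₃ A') t =
        ((1 - t) • A + t • A', b + t • (A ⨯₃ A')) := by
      ext i <;> simp [AffineMap.lineMap_apply] <;> ring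
    have e2 : (A', b + A ⨯₃ A') - (A, b) = (A' - A, A ⨯₃ A') := by simp
    have h3 : A ⨯₃ A' ⬝ᵥ A = 0 := by rw [dotProduct_comm, dot_self_cross]
    have h4 : A ⨯₃ A' ⬝ᵥ A' = 0 := by rw [dotProduct_comm, dot_cross_self]
    rw [e1, e2]
    refine ⟨?_, ?_, ?_⟩
    · change (b + t • (A ⨯₃ A')) ⬝ᵥ ((1 - t) • A + t • A') = 1
      simp only [add_dotProduct, dotProduct_add, smul_dotProduct, dotProduct_smul, h1, h2, h3, h4,
        smul_eq_mul]
      ring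
    · simp only [add_dotProduct, dotProduct_add, dotProduct_sub, smul_dotProduct, dotProduct_smul,
        h1, h2, h3, h4, smul_eq_mul]
      ring
    · simp only [map_add, map_sub, map_smul, LinearMap.add_apply, LinearMap.smul_apply, cross_self]
      rw [← cross_anticomm A A']
      module

theorem dot_eq_one_of_edge {A b A' b' : Vec3} (h' : b' ⬝ᵥ A' = 1) (h : b' - b = A ⨯₃ A') :
    b ⬝ᵥ A' = 1 := by
  have e : b = b' - A ⨯₃ A' := by rw [← h]; simp
  rw [e, sub_dotProduct, h', dotProduct_comm, dot_cross_self, sub_zero]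

theorem succ_dot_eq_one_of_edge {A b A' b' : Vec3} (h₀ : b ⬝ᵥ A = 1) (h : b' - b = A ⨯₃ A') :
    b' ⬝ᵥ A = 1 := by
  have e : b' = b + A ⨯₃ A' := by rw [← h]; simp
  rw [e, add_dotProduct, h₀, dotProduct_comm, dot_self_cross, add_zero]

theorem linearIndependent_iff_triple_ne_zero (u v w : Vec3) :
    LinearIndependent ℝ ![u, v, w] ↔ u ⬝ᵥ v ⨯₃ w ≠ 0 := by
  rw [triple_product_eq_det, ← isUnit_iff_ne_zero]
  exact Matrix.linearIndependent_rows_iff_isUnit.trans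
    (Matrix.isUnit_iff_isUnit_det (Matrix.of ![u, v, w]))

/-- The cross product of two vectors orthogonal to `b` is a multiple of `b`. -/
theorem cross_eq_triple_smul {A b u w : Vec3} (h : b ⬝ᵥ A = 1) (hu : b ⬝ᵥ u = 0)
    (hw : b ⬝ᵥ w = 0) : u ⨯₃ w = (A ⬝ᵥ u ⨯₃ w) • b := by
  simp only [dotProduct, Fin.sum_univ_three] at h hu hw
  ext i
  fin_cases i <;> simp [cross_apply, dotProduct, Fin.sum_univ_three]
  · linear_combination (-(u 1 * w 2 - u 2 * w 1)) * h + (A 1 * w 2 - A 2 * w 1) * hu +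
      (A 2 * u 1 - A 1 * u 2) * hw
  · linear_combination (-(u 2 * w 0 - u 0 * w 2)) * h + (A 2 * w 0 - A 0 * w 2) * hu +
      (A 0 * u 2 - A 2 * u 0) * hw
  · linear_combination (-(u 0 * w 1 - u 1 * w 0)) * h + (A 0 * w 1 - A 1 * w 0) * hu +
      (A 1 * u 0 - A 0 * u 1) * hw

section Triple

variable {A₀ A₁ A₂ b₀ b₁ b₂ : Vec3}

/-- Along two consecutive horizontal edges, the `𝐛`-components of the three vertices have the same
determinant as the `𝐀`-components. -/
theorem triple_lines_eq (h₁ : b₁ ⬝ᵥ A₁ = 1) (h01 : b₁ - b₀ = A₀ ⨯₃ A₁) (h12 : b₂ - b₁ = A₁ ⨯₃ A₂) :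
    b₀ ⬝ᵥ b₁ ⨯₃ b₂ = A₀ ⬝ᵥ A₁ ⨯₃ A₂ := by
  have e0 : b₀ = b₁ - A₀ ⨯₃ A₁ := by rw [← h01]; simp
  have e2 : b₂ = b₁ + A₁ ⨯₃ A₂ := by rw [← h12]; simp
  subst e0 e2
  simp only [dotProduct, Fin.sum_univ_three] at h₁
  simp [cross_apply, dotProduct, Fin.sum_univ_three, Matrix.vecHead, Matrix.vecTail]
  linear_combination (A₀ 0 * (A₁ 1 * A₂ 2 - A₁ 2 * A₂ 1) + A₀ 1 * (A₁ 2 * A₂ 0 - A₁ 0 * A₂ 2) +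
    A₀ 2 * (A₁ 0 * A₂ 1 - A₁ 1 * A₂ 0)) * h₁

theorem triple_eq_neg_triple_sub (u v w : Vec3) :
    u ⬝ᵥ v ⨯₃ w = -(v ⬝ᵥ (u - v) ⨯₃ (w - v)) := by
  simp [cross_apply, dotProduct, Fin.sum_univ_three]
  ring

/-- The determinant of the `𝐀ᵢ + 𝐛ᵢ` is a positive multiple of that of the `𝐀ᵢ`, so that the two
vanish together. -/
theorem triple_sum_eq (h₁ : b₁ ⬝ᵥ A₁ = 1) (h₀' : b₁ ⬝ᵥ A₀ = 1) (h₂' : b₁ ⬝ᵥ A₂ = 1)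
    (h01 : b₁ - b₀ = A₀ ⨯₃ A₁) (h12 : b₂ - b₁ = A₁ ⨯₃ A₂) :
    (A₀ + b₀) ⬝ᵥ (A₁ + b₁) ⨯₃ (A₂ + b₂) =
      ((A₁ + b₁) ⬝ᵥ (A₁ + b₁)) * (A₀ ⬝ᵥ A₁ ⨯₃ A₂) := by
  rw [triple_eq_neg_triple_sub, triple_eq_neg_triple_sub A₀]
  set u := A₀ - A₁ with hu
  set w := A₂ - A₁ with hw
  have e0 : A₀ + b₀ - (A₁ + b₁) = u + A₁ ⨯₃ u := by
    have : b₀ = b₁ - A₀ ⨯₃ A₁ := by rw [← h01]; simp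
    rw [hu, this, map_sub, cross_self, ← cross_anticomm A₀ A₁]
    abel
  have e2 : A₂ + b₂ - (A₁ + b₁) = w + A₁ ⨯₃ w := by
    have : b₂ = b₁ + A₁ ⨯₃ A₂ := by rw [← h12]; simp
    rw [hw, this, map_sub, cross_self]
    abel
  have hc : u ⨯₃ w = (A₁ ⬝ᵥ u ⨯₃ w) • b₁ := by
    apply cross_eq_triple_smul h₁
    · rw [hu, dotProduct_sub, h₀', h₁, sub_self]
    · rw [hw, dotProduct_sub, h₂', h₁, sub_self]
  have e3 : (u + A₁ ⨯₃ u) ⨯₃ (w + A₁ ⨯₃ w) =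
      u ⨯₃ w + A₁ ⨯₃ (u ⨯₃ w) + (A₁ ⬝ᵥ u ⨯₃ w) • A₁ := by
    ext i
    fin_cases i <;>
      simp [cross_apply, dotProduct, Fin.sum_univ_three, Matrix.vecHead, Matrix.vecTail] <;> ring
  rw [e0, e2, e3]
  set k := A₁ ⬝ᵥ u ⨯₃ w
  have e4 : (A₁ + b₁) ⬝ᵥ A₁ ⨯₃ b₁ = 0 := by
    rw [add_dotProduct, dot_self_cross, dot_cross_self, add_zero]
  rw [hc, map_smul, dotProduct_add, dotProduct_add, dotProduct_smul, dotProduct_smul,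
    dotProduct_smul, e4, dotProduct_add (A₁ + b₁) A₁ b₁]
  simp only [smul_eq_mul]
  ring

/-- Two consecutive horizontal edges lie on a line exactly if the points of their three vertices
are dependent. -/
theorem collinear_iff_triple_eq_zero (h₁ : b₁ ⬝ᵥ A₁ = 1) (h₀' : b₁ ⬝ᵥ A₀ = 1)
    (h₂' : b₁ ⬝ᵥ A₂ = 1) (h01 : b₁ - b₀ = A₀ ⨯₃ A₁) (h12 : b₂ - b₁ = A₁ ⨯₃ A₂)
    (hne : A₀ ≠ A₁) :
    Collinear ℝ {(A₀, b₀), (A₁, b₁), (A₂, b₂)} ↔ A₀ ⬝ᵥ A₁ ⨯₃ A₂ = 0 := by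
  rw [collinear_iff_of_mem (p₀ := (A₁, b₁)) (by simp), triple_eq_neg_triple_sub, neg_eq_zero]
  constructor
  · rintro ⟨v, hv⟩
    obtain ⟨r, hr⟩ := hv (A₀, b₀) (by simp)
    obtain ⟨s, hs⟩ := hv (A₂, b₂) (by simp)
    have e0 : A₀ - A₁ = r • v.1 := by
      have := congrArg Prod.fst hr
      simp at this
      rw [this, add_sub_cancel_right]
    have e2 : A₂ - A₁ = s • v.1 := by
      have := congrArg Prod.fst hs
      simp at this
      rw [this, add_sub_cancel_right]
    rw [e0, e2]
    simp [cross_self]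
  · intro h
    have hc := cross_eq_triple_smul (A := A₁) (b := b₁) (u := A₀ - A₁) (w := A₂ - A₁) h₁
      (by rw [dotProduct_sub, h₀', h₁, sub_self]) (by rw [dotProduct_sub, h₂', h₁, sub_self])
    rw [h, zero_smul] at hc
    have h3 : ¬ LinearIndependent ℝ ![A₀ - A₁, A₂ - A₁] := by
      rw [← crossProduct_ne_zero_iff_linearIndependent, not_not]
      exact hc
    rw [LinearIndependent.pair_iff' (sub_ne_zero.2 hne)] at h3
    push Not at h3
    obtain ⟨r, hr⟩ := h3
    have e0 : b₀ - b₁ = A₁ ⨯₃ (A₀ - A₁) := by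
      rw [map_sub, cross_self, ← cross_anticomm A₀ A₁, ← h01]
      abel
    have e2 : b₂ - b₁ = A₁ ⨯₃ (A₂ - A₁) := by rw [map_sub, cross_self, h12, sub_zero]
    refine ⟨(A₀ - A₁, b₀ - b₁), ?_⟩
    simp only [Set.mem_insert_iff, Set.mem_singleton_iff, forall_eq_or_imp, forall_eq]
    refine ⟨⟨1, by simp⟩, ⟨0, by simp⟩, ⟨r, ?_⟩⟩
    have e3 : r • (b₀ - b₁) = b₂ - b₁ := by rw [e0, e2, ← hr, map_smul]
    simp [hr, e3]

end Triple

/-! ### Points of `Qdan` and of `S² × S³` with the same image -/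

/-- The vector `(𝐀 + 𝐛) / 2`; the points `(v, q)` of `S² × S³` with the same image as `(𝐀, 𝐛)` have
`v` on the line it spans. -/
noncomputable def halfSum (R : Qdan) : Vec3 := (1 / 2 : ℝ) • (R.1.1 + R.1.2)

/-- The vector `(𝐀 - 𝐛) / 2`; the points `(v, q)` of `S² × S³` with the same image as `(𝐀, 𝐛)` have
the imaginary part of `v q` on the line it spans. -/
noncomputable def halfDiff (R : Qdan) : Vec3 := (1 / 2 : ℝ) • (R.1.1 - R.1.2)

theorem fst_eq (R : Qdan) : R.1.1 = halfSum R + halfDiff R := by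
  rw [halfSum, halfDiff]
  module

theorem snd_eq (R : Qdan) : R.1.2 = halfSum R - halfDiff R := by
  rw [halfSum, halfDiff]
  module

theorem halfSum_dot_self (R : Qdan) :
    halfSum R ⬝ᵥ halfSum R = 1 + halfDiff R ⬝ᵥ halfDiff R := by
  have h : R.1.2 ⬝ᵥ R.1.1 = 1 := R.2
  rw [fst_eq, snd_eq, sub_dotProduct, dotProduct_add, dotProduct_add,
    dotProduct_comm (halfDiff R) (halfSum R)] at h
  linarith

theorem halfSum_dot_self_pos (R : Qdan) : 0 < halfSum R ⬝ᵥ halfSum R := by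
  rw [halfSum_dot_self]
  have : 0 ≤ halfDiff R ⬝ᵥ halfDiff R := by
    simp only [dotProduct, Fin.sum_univ_three]
    nlinarith [mul_self_nonneg (halfDiff R 0), mul_self_nonneg (halfDiff R 1),
      mul_self_nonneg (halfDiff R 2)]
  linarith

theorem imQ_halfSum_ne_zero (R : Qdan) : imQ (halfSum R) ≠ 0 := by
  intro h
  have h1 := halfSum_dot_self_pos R
  have h2 : halfSum R = 0 := by rw [← vecIm_imQ (halfSum R), h]; ext i; fin_cases i <;> rfl
  simp [h2] at h1

/-- The points `(v, q)` over `(𝐀, 𝐛)`, in quaternionic form. -/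
theorem iota_eq_phi_iff (R : Qdan) (v : S2) (q : S3) : iota R = phi v q ↔
    ∃ s : ℝ, s ≠ 0 ∧ v.1 = s • halfSum R ∧
      imQ v.1 * (q : ℍ[ℝ]) = s • (1 + imQ (halfDiff R)) := by
  refine (eq_comm.trans Subtype.ext_iff).trans ((Projectivization.mk_eq_mk_iff' ..).trans ?_)
  constructor
  · rintro ⟨s, hs⟩
    set z := imQ v.1 * (q : ℍ[ℝ]) with hz
    have e0 : s = z.re := (mul_one s).symm.trans (congrArg (fun ζ : ImOct => ζ.1) hs)
    have e1 : s • R.1.1 = v.1 + vecIm z := congrArg (fun ζ : ImOct => ζ.2.1) hs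
    have e2 : s • R.1.2 = v.1 - vecIm z := congrArg (fun ζ : ImOct => ζ.2.2) hs
    have e3 : v.1 = s • halfSum R := by
      rw [halfSum, smul_comm, smul_add, e1, e2]
      module
    have e4 : vecIm z = s • halfDiff R := by
      rw [halfDiff, smul_comm, smul_sub, e1, e2]
      module
    refine ⟨s, ?_, e3, ?_⟩
    · rintro rfl
      have h := v.2
      rw [e3] at h
      simp at h
    · have e5 : z = s • (1 : ℍ[ℝ]) + imQ (vecIm z) := by
        ext <;> simp [vecIm, e0]
      rw [e5, e4, imQ_smul, smul_add]
  · rintro ⟨s, hs, h1, h2⟩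
    refine ⟨s, ?_⟩
    have e : vecIm (s • (1 + imQ (halfDiff R))) = s • halfDiff R := by
      ext i
      fin_cases i <;> simp [vecIm]
    rw [phiMatrix, h2, e, h1, fst_eq, snd_eq, ← smul_add, ← smul_sub]
    ext i <;> simp [mul_add]

/-- With `𝐀 = x + y` and `𝐛 = x - y`, the edge equation of `Qdan` says `x' (1 + y) = x (1 + y')`
in the quaternions. -/
theorem edge_iff (R R' : Qdan) : R'.1.2 - R.1.2 = R.1.1 ⨯₃ R'.1.1 ↔
    imQ (halfSum R') * (1 + imQ (halfDiff R)) = imQ (halfSum R) * (1 + imQ (halfDiff R')) := by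
  constructor
  · intro h
    obtain ⟨⟨A, b⟩, hR⟩ := R
    obtain ⟨⟨A', b'⟩, hR'⟩ := R'
    simp only at h
    have h1 : b ⬝ᵥ A = 1 := hR
    have h2 : b ⬝ᵥ A' = 1 := dot_eq_one_of_edge hR' h
    have e : b' = b + A ⨯₃ A' := by rw [← h]; simp
    subst e
    simp only [dotProduct, Fin.sum_univ_three] at h1 h2
    ext <;> simp [halfSum, halfDiff, cross_apply, Matrix.vecHead, Matrix.vecTail]
    · linear_combination (-1 / 2 : ℝ) * h1 + (1 / 2 : ℝ) * h2
    · linear_combination (A 0 / 2) * h2 - (A' 0 / 2) * h1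
    · linear_combination (A 1 / 2) * h2 - (A' 1 / 2) * h1
    · linear_combination (A 2 / 2) * h2 - (A' 2 / 2) * h1
  · intro h
    have h1 : (1 + imQ (halfDiff R')) * (1 - imQ (halfDiff R)) =
        -(imQ (halfSum R) * imQ (halfSum R')) := by
      apply mul_left_cancel₀ (imQ_halfSum_ne_zero R)
      have e1 : (1 + imQ (halfDiff R)) * (1 - imQ (halfDiff R)) =
          ((halfSum R ⬝ᵥ halfSum R : ℝ) : ℍ[ℝ]) := by
        rw [halfSum_dot_self, add_mul, mul_sub, mul_sub, imQ_mul_self]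
        push_cast
        rw [sub_neg_eq_add, one_mul, one_mul, mul_one]
        abel
      rw [← mul_assoc, ← h, mul_assoc, e1, mul_neg, ← mul_assoc, imQ_mul_self,
        Quaternion.coe_neg, neg_mul, neg_neg, Quaternion.coe_commutes]
    rw [snd_eq, snd_eq, fst_eq, fst_eq]
    have a1 := congrArg QuaternionAlgebra.imI h
    have a2 := congrArg QuaternionAlgebra.imJ h
    have a3 := congrArg QuaternionAlgebra.imK h
    have c1 := congrArg QuaternionAlgebra.imI h1
    have c2 := congrArg QuaternionAlgebra.imJ h1
    have c3 := congrArg QuaternionAlgebra.imK h1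
    simp at a1 a2 a3 c1 c2 c3
    ext i
    fin_cases i <;> simp [cross_apply]
    · linear_combination a1 - c1
    · linear_combination a2 - c2
    · linear_combination a3 - c3

/-- An edge of `Qdan` is horizontal if and only if the edge between the corresponding points of
`S² × S³` is a rolling motion. -/
theorem edge_iff_rolling {R R' : Qdan} {v v' : S2} {q q' : S3} (h : iota R = phi v q)
    (h' : iota R' = phi v' q') : R'.1.2 - R.1.2 = R.1.1 ⨯₃ R'.1.1 ↔
      (q' : ℍ[ℝ]) = (imQ v'.1 * imQ v.1) ^ 2 * q := by
  obtain ⟨s, hs, h1, h2⟩ := (iota_eq_phi_iff _ _ _).1 h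
  obtain ⟨s', hs', h1', h2'⟩ := (iota_eq_phi_iff _ _ _).1 h'
  rw [edge_iff]
  have hv : imQ v.1 * imQ v.1 = -1 := by rw [imQ_mul_self, v.2]; simp
  have hv' : imQ v'.1 * imQ v'.1 = -1 := by rw [imQ_mul_self, v'.2]; simp
  have hv0 : imQ v.1 ≠ 0 := fun h => by simp [h] at hv
  have hv0' : imQ v'.1 ≠ 0 := fun h => by simp [h] at hv'
  -- multiply both sides of the edge equation by `s s'`
  have k1 : (s * s') • (imQ (halfSum R') * (1 + imQ (halfDiff R))) =
      imQ v'.1 * (imQ v.1 * (q : ℍ[ℝ])) := by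
    rw [h2, h1', imQ_smul, smul_mul_smul_comm, mul_comm s]
  have k2 : (s * s') • (imQ (halfSum R) * (1 + imQ (halfDiff R'))) =
      imQ v.1 * (imQ v'.1 * (q' : ℍ[ℝ])) := by
    rw [h2', h1, imQ_smul, smul_mul_smul_comm]
  have hss : s * s' ≠ 0 := mul_ne_zero hs hs'
  rw [← (smul_right_injective ℍ[ℝ] hss).eq_iff]
  rw [k1, k2]
  have k3 : imQ v'.1 * (imQ v.1 * (imQ v.1 * (imQ v'.1 * (q' : ℍ[ℝ])))) = q' := by
    rw [← mul_assoc (imQ v.1) (imQ v.1), hv, neg_one_mul, mul_neg, ← mul_assoc, hv', neg_one_mul,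
      neg_neg]
  constructor
  · intro e
    rw [← k3, ← e]
    simp only [sq, mul_assoc]
  · intro e
    rw [← k3] at e
    simp only [sq, mul_assoc] at e
    exact (mul_left_cancel₀ hv0 (mul_left_cancel₀ hv0' e)).symm

/-- Every point of `Qdan` has the same image as some point of `S² × S³`. -/
theorem exists_iota_eq_phi (R : Qdan) : ∃ (v : S2) (q : S3), iota R = phi v q := by
  have hpos := halfSum_dot_self_pos R
  set m := halfSum R ⬝ᵥ halfSum R with hm
  set s := (Real.sqrt m)⁻¹ with hs
  have hs2 : s * s * m = 1 := by
    have := Real.mul_self_sqrt hpos.le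
    have h0 := (Real.sqrt_pos.2 hpos).ne'
    rw [hs]
    field_simp
    nlinarith
  have hs0 : s ≠ 0 := (inv_pos.2 (Real.sqrt_pos.2 hpos)).ne'
  let v : S2 := ⟨s • halfSum R, by
    rw [smul_dotProduct, dotProduct_smul, smul_eq_mul, smul_eq_mul, ← mul_assoc, ← hm, hs2]⟩
  have hv : imQ v.1 * imQ v.1 = -1 := by rw [imQ_mul_self, v.2]; simp
  have hq : ‖-(imQ v.1 * (s • (1 + imQ (halfDiff R))))‖ = 1 := by
    apply norm_eq_one_of_star_mul_self
    rw [star_neg, star_mul, star_imQ, neg_mul_neg, mul_assoc, ← mul_assoc (-imQ v.1), neg_mul, hv]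
    have e : star (s • (1 + imQ (halfDiff R))) = s • (1 - imQ (halfDiff R)) := by
      ext <;> simp
    rw [e, neg_neg, one_mul, smul_mul_smul_comm, sub_mul, mul_add, mul_add, imQ_mul_self]
    have e2 : (1 : ℍ[ℝ]) = ((s * s * (1 + halfDiff R ⬝ᵥ halfDiff R) : ℝ) : ℍ[ℝ]) := by
      rw [← halfSum_dot_self, ← hm, hs2, Quaternion.coe_one]
    conv_rhs => rw [e2]
    ext <;> simp
  refine ⟨v, ⟨-(imQ v.1 * (s • (1 + imQ (halfDiff R)))), by simpa using hq⟩, ?_⟩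
  rw [iota_eq_phi_iff]
  refine ⟨s, hs0, rfl, ?_⟩
  rw [mul_neg, ← mul_assoc, hv, neg_one_mul, neg_neg]

/-- Two points of `S² × S³` over the same point of `Qdan` differ at most by the sign of `v`. -/
theorem eq_or_neg_of_iota_eq {R : Qdan} {v v' : S2} {q q' : S3} (h : iota R = phi v q)
    (h' : iota R = phi v' q') : q = q' ∧ (v'.1 = v.1 ∨ v'.1 = -v.1) := by
  obtain ⟨s, hs, h1, h2⟩ := (iota_eq_phi_iff _ _ _).1 h
  obtain ⟨s', hs', h1', h2'⟩ := (iota_eq_phi_iff _ _ _).1 h'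
  have hv : imQ v.1 * imQ v.1 = -1 := by rw [imQ_mul_self, v.2]; simp
  have hv0 : imQ v.1 ≠ 0 := fun h => by simp [h] at hv
  have hss : s' * s' = s * s := by
    have e := v.2
    have e' := v'.2
    rw [h1, smul_dotProduct, dotProduct_smul, smul_eq_mul, smul_eq_mul] at e
    rw [h1', smul_dotProduct, dotProduct_smul, smul_eq_mul, smul_eq_mul] at e'
    have := halfSum_dot_self_pos R
    apply mul_right_cancel₀ this.ne'
    linarith
  rcases mul_self_eq_mul_self_iff.1 hss with e | e
  · have hvv : v'.1 = v.1 := by rw [h1', h1, e]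
    refine ⟨Subtype.ext (mul_left_cancel₀ hv0 ?_), Or.inl hvv⟩
    rw [h2, ← hvv, h2', e]
  · have hvv : v'.1 = -v.1 := by rw [h1', h1, e, neg_smul]
    refine ⟨Subtype.ext (mul_left_cancel₀ hv0 ?_), Or.inr hvv⟩
    rw [hvv, imQ_neg, e, neg_mul, neg_smul] at h2'
    rw [h2, neg_injective h2']

theorem phi_eq_of_eq_or_neg {v v' : S2} (h : v'.1 = v.1 ∨ v'.1 = -v.1) (q : S3) :
    phi v' q = phi v q := by
  rcases h with h | h
  · rw [Subtype.ext h]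
  · refine Subtype.ext ((Projectivization.mk_eq_mk_iff' ..).2 ⟨-1, ?_⟩)
    rw [phiMatrix, phiMatrix, h, imQ_neg, neg_mul]
    ext i
    · simp
    · fin_cases i <;> simp [vecIm, Matrix.vecHead, Matrix.vecTail] <;> ring
    · fin_cases i <;> simp [vecIm, Matrix.vecHead, Matrix.vecTail] <;> ring

theorem iota_injective : Function.Injective iota := by
  intro R R' h
  obtain ⟨c, hc⟩ := (Projectivization.mk_eq_mk_iff' ..).1 (Subtype.ext_iff.1 h)
  have e0 : c = 1 := by simpa using congrArg (fun ζ : ImOct => ζ.1) hc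
  rw [e0, one_smul] at hc
  exact Subtype.ext (Prod.ext (congrArg (fun ζ : ImOct => ζ.2.1) hc).symm
    (congrArg (fun ζ : ImOct => ζ.2.2) hc).symm)

/-! ### Homogeneous coordinates in the projective plane -/

/-- `u` is a vector of homogeneous coordinates of `p`. -/
def IsRep (u : Vec3) (p : ℙ ℝ Vec3) : Prop := ∃ h : u ≠ 0, p = Projectivization.mk ℝ u h

theorem exists_isRep (p : ℙ ℝ Vec3) : ∃ u, IsRep u p :=
  ⟨p.rep, p.rep_nonzero, p.mk_rep.symm⟩

theorem IsRep.smul {u : Vec3} {p : ℙ ℝ Vec3} (h : IsRep u p) {c : ℝ} (hc : c ≠ 0) :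
    IsRep (c • u) p := by
  obtain ⟨h0, rfl⟩ := h
  exact ⟨smul_ne_zero hc h0, (Projectivization.mk_eq_mk_iff' ..).2 ⟨c⁻¹, by
    rw [smul_smul, inv_mul_cancel₀ hc, one_smul]⟩⟩

theorem IsRep.exists_smul {u w : Vec3} {p : ℙ ℝ Vec3} (h : IsRep u p) (h' : IsRep w p) :
    ∃ c : ℝ, c ≠ 0 ∧ w = c • u := by
  obtain ⟨h0, rfl⟩ := h
  obtain ⟨h0', e⟩ := h'
  obtain ⟨c, hc⟩ := (Projectivization.mk_eq_mk_iff' ..).1 e.symm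
  refine ⟨c, ?_, hc.symm⟩
  rintro rfl
  exact h0' (by rw [← hc, zero_smul])

theorem IsRep.eq {u : Vec3} {p p' : ℙ ℝ Vec3} (h : IsRep u p) (h' : IsRep u p') : p = p' := by
  obtain ⟨h0, rfl⟩ := h
  obtain ⟨h0', rfl⟩ := h'
  rfl

theorem IsRep.incident_iff {A b : Vec3} {p l : ℙ ℝ Vec3} (h : IsRep A p) (h' : IsRep b l) :
    Incident p l ↔ b ⬝ᵥ A = 0 := by
  obtain ⟨h0, rfl⟩ := h
  obtain ⟨h0', rfl⟩ := h'
  exact Projectivization.orthogonal_mk h0' h0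

theorem IsRep.cross {u w : Vec3} {p p' : ℙ ℝ Vec3} (h : IsRep u p) (h' : IsRep w p')
    (hne : u ⨯₃ w ≠ 0) : IsRep (u ⨯₃ w) (Projectivization.cross p p') := by
  obtain ⟨h0, rfl⟩ := h
  obtain ⟨h0', rfl⟩ := h'
  exact ⟨hne, Projectivization.cross_mk_of_cross_ne_zero h0 h0' hne⟩

theorem triple_smul (a b c : ℝ) (u v w : Vec3) :
    (a • u) ⬝ᵥ (b • v) ⨯₃ (c • w) = a * b * c * (u ⬝ᵥ v ⨯₃ w) := by
  simp only [map_smul, LinearMap.smul_apply, smul_dotProduct, dotProduct_smul, smul_eq_mul]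
  ring

theorem independent_iff_triple_ne_zero {u v w : Vec3} {p p' p'' : ℙ ℝ Vec3} (h : IsRep u p)
    (h' : IsRep v p') (h'' : IsRep w p'') :
    Projectivization.Independent ![p, p', p''] ↔ u ⬝ᵥ v ⨯₃ w ≠ 0 := by
  obtain ⟨a, ha, ea⟩ := h.exists_smul ⟨p.rep_nonzero, p.mk_rep.symm⟩
  obtain ⟨b, hb, eb⟩ := h'.exists_smul ⟨p'.rep_nonzero, p'.mk_rep.symm⟩
  obtain ⟨c, hc, ec⟩ := h''.exists_smul ⟨p''.rep_nonzero, p''.mk_rep.symm⟩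
  have e : Projectivization.rep ∘ ![p, p', p''] = ![a • u, b • v, c • w] := by
    rw [← ea, ← eb, ← ec]
    ext1 i
    fin_cases i <;> rfl
  rw [Projectivization.independent_iff, e, linearIndependent_iff_triple_ne_zero, triple_smul]
  simp [ha, hb, hc]

/-! ### Cross-ratios and the dancing condition in homogeneous coordinates -/

theorem HasAffineCoord.exists_smul {u w e : Vec3} {p : RP2} {x : ℝ} (h : HasAffineCoord u w p x)
    (he : IsRep e p) : ∃ α : ℝ, α ≠ 0 ∧ e = α • u + (α * x) • w := by
  obtain ⟨α, hα, h1⟩ := IsRep.exists_smul h he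
  exact ⟨α, hα, by rw [h1, smul_add, smul_smul]⟩

theorem hasAffineCoord_of_smul {u w e : Vec3} {p : RP2} {x α : ℝ} (he : IsRep e p) (hα : α ≠ 0)
    (h : e = α • (u + x • w)) : HasAffineCoord u w p x := by
  have h1 := he.smul (inv_ne_zero hα)
  rw [h, smul_smul, inv_mul_cancel₀ hα, one_smul] at h1
  exact h1

/-- The cross-ratio of `f, e - f, e, δ f - e` is `1 - δ`. -/
theorem HasCrossRatio.eq_one_sub {e f : Vec3} {p₁ p₂ p₃ p₄ : RP2} {δ r : ℝ} (h₁ : IsRep f p₁)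
    (h₂ : IsRep (e - f) p₂) (h₃ : IsRep e p₃) (h₄ : IsRep (δ • f - e) p₄)
    (h : HasCrossRatio p₁ p₂ p₃ p₄ r) : r = 1 - δ := by
  obtain ⟨u, w, huw, x₁, x₂, x₃, x₄, c₁, c₂, c₃, c₄, hne, rfl⟩ := h
  obtain ⟨a₁, ha₁, e₁⟩ := c₁.exists_smul h₁
  obtain ⟨a₂, ha₂, e₂⟩ := c₂.exists_smul h₂
  obtain ⟨a₃, ha₃, e₃⟩ := c₃.exists_smul h₃
  obtain ⟨a₄, ha₄, e₄⟩ := c₄.exists_smul h₄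
  have hz := LinearIndependent.pair_iff.1 huw
  rw [e₁, e₃] at e₂ e₄
  obtain ⟨f₁, f₂⟩ := hz (a₃ - a₁ - a₂) (a₃ * x₃ - a₁ * x₁ - a₂ * x₂) (by
    rw [← sub_eq_zero.2 e₂]
    module)
  obtain ⟨g₁, g₂⟩ := hz (δ * a₁ - a₃ - a₄) (δ * (a₁ * x₁) - a₃ * x₃ - a₄ * x₄) (by
    rw [← sub_eq_zero.2 e₄]
    module)
  rw [div_eq_iff hne]
  apply mul_left_cancel₀ (mul_ne_zero ha₂ ha₄)
  have k₁ : a₂ * (x₂ - x₃) = a₁ * (x₃ - x₁) := by linear_combination f₁ * x₃ - f₂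
  have k₂ : a₄ * (x₁ - x₄) = a₃ * (x₃ - x₁) := by linear_combination g₂ - g₁ * x₁
  have k₃ : a₂ * a₄ * (x₂ - x₄) = a₁ * a₃ * (1 - δ) * (x₁ - x₃) := by
    have b₂ : a₂ = a₃ - a₁ := by linarith
    have b₄ : a₄ = δ * a₁ - a₃ := by linarith
    have d₂ : a₂ * x₂ = a₃ * x₃ - a₁ * x₁ := by linarith
    have d₄ : a₄ * x₄ = δ * (a₁ * x₁) - a₃ * x₃ := by linarith
    calc a₂ * a₄ * (x₂ - x₄) = a₄ * (a₂ * x₂) - a₂ * (a₄ * x₄) := by ring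
      _ = _ := by rw [d₂, d₄, b₂, b₄]; ring
  calc a₂ * a₄ * ((x₁ - x₃) * (x₂ - x₄)) = (x₁ - x₃) * (a₂ * a₄ * (x₂ - x₄)) := by ring
    _ = (1 - δ) * ((a₄ * (x₁ - x₄)) * (a₂ * (x₂ - x₃))) := by rw [k₁, k₂, k₃]; ring
    _ = _ := by ring

theorem hasCrossRatio_one_sub {e f : Vec3} {p₁ p₂ p₃ p₄ : RP2} {δ : ℝ}
    (hef : LinearIndependent ℝ ![f, e]) (h₁ : IsRep f p₁)
    (h₂ : IsRep (e - f) p₂) (h₃ : IsRep e p₃) (h₄ : IsRep (δ • f - e) p₄) :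
    HasCrossRatio p₁ p₂ p₃ p₄ (1 - δ) := by
  -- `e + m f` is a point of the line that differs from the four given points
  set m : ℝ := |δ| + 1 with hm
  have hδ := abs_nonneg δ
  have hδ' := neg_abs_le δ
  have m1 : m ≠ 0 := by positivity
  have m2 : m + 1 ≠ 0 := by positivity
  have m3 : δ + m ≠ 0 := by
    have : 0 < δ + m := by linarith
    exact this.ne'
  suffices h : ∃ r, HasCrossRatio p₁ p₂ p₃ p₄ r by
    obtain ⟨r, hr⟩ := h
    rwa [hr.eq_one_sub h₁ h₂ h₃ h₄] at hr
  refine ⟨_, f, e + m • f, ?_, 0, -(m + 1)⁻¹, -m⁻¹, -(δ + m)⁻¹,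
    hasAffineCoord_of_smul h₁ one_ne_zero ?_,
    hasAffineCoord_of_smul h₂ (neg_ne_zero.2 m2) ?_,
    hasAffineCoord_of_smul h₃ (neg_ne_zero.2 m1) ?_,
    hasAffineCoord_of_smul h₄ m3 ?_, ?_, rfl⟩
  · rw [LinearIndependent.pair_iff] at hef ⊢
    intro s t hst
    obtain ⟨k1, k2⟩ := hef (s + t * m) t (by rw [← hst]; module)
    subst k2
    simpa using k1
  · simp
  · match_scalars <;> field_simp
    ring
  · match_scalars <;> field_simp
    ring
  · match_scalars <;> field_simp
    ring
  · refine mul_ne_zero ?_ ?_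
    · simpa using m3
    · rw [neg_sub_neg, inv_eq_one_div, inv_eq_one_div, div_sub_div _ _ m1 m2]
      refine div_ne_zero ?_ (mul_ne_zero m1 m2)
      simp

/-- The dancing condition at a vertex, for homogeneous coordinates normalised along the two edges
that meet there: the two factors of proportionality agree. -/
theorem dancing_iff {n : ℕ} (P : PolygonPair n) (i : ZMod n) {A₀ A₁ A₂ b₀ b₁ b₂ : Vec3}
    (hA₀ : IsRep A₀ (P.A i)) (hA₁ : IsRep A₁ (P.A (i + 1))) (hA₂ : IsRep A₂ (P.A (i + 2)))
    (hb₀ : IsRep b₀ (P.b i)) (hb₁ : IsRep b₁ (P.b (i + 1))) (hb₂ : IsRep b₂ (P.b (i + 2)))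
    (h00 : b₀ ⬝ᵥ A₀ = 1) (h01 : b₀ ⬝ᵥ A₁ = 1) (h11 : b₁ ⬝ᵥ A₁ = 1) (h12 : b₁ ⬝ᵥ A₂ = 1)
    (h21 : b₂ ⬝ᵥ A₁ = 1) {μ ν : ℝ} (hμ : μ ≠ 0) (hν : ν ≠ 0)
    (e01 : b₁ - b₀ = μ • (A₀ ⨯₃ A₁)) (e12 : b₂ - b₁ = ν • (A₁ ⨯₃ A₂))
    (hD : A₀ ⬝ᵥ A₁ ⨯₃ A₂ ≠ 0) :
    (∃ r s : ℝ,
      HasCrossRatio (P.A (i + 1)) (P.B i) (P.A i) (meet (P.a i) (P.b (i + 2))) r ∧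
      HasCrossRatio (P.A (i + 1)) (P.B (i + 1)) (P.A (i + 2)) (meet (P.b i) (P.a (i + 1))) s ∧
      r + s = 0) ↔ μ = ν := by
  have hi : i + 1 + 1 = i + 2 := by rw [add_assoc, one_add_one_eq_two]
  have l10 : A₀ ⨯₃ A₁ ≠ 0 := by
    intro h
    rw [triple_product_permutation, triple_product_permutation, h] at hD
    simp at hD
  have l12 : A₁ ⨯₃ A₂ ≠ 0 := by
    intro h
    simp [h] at hD
  have n0 : A₀ ≠ A₁ := by
    rintro rfl
    simp [cross_self] at l10
  have n2 : A₂ ≠ A₁ := by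
    rintro rfl
    simp [cross_self] at l12
  have i10 : LinearIndependent ℝ ![A₁, A₀] := by
    rw [← crossProduct_ne_zero_iff_linearIndependent, ← cross_anticomm]
    exact neg_ne_zero.2 l10
  have i12 : LinearIndependent ℝ ![A₁, A₂] := by
    rwa [← crossProduct_ne_zero_iff_linearIndependent]
  set δ := b₂ ⬝ᵥ A₀ with hδ
  set γ := b₀ ⬝ᵥ A₂ with hγ
  have hδ' : δ = 1 + ν * (A₀ ⬝ᵥ A₁ ⨯₃ A₂) := by
    have e : b₂ = b₁ + ν • (A₁ ⨯₃ A₂) := by rw [← e12]; simp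
    have e' : b₁ = b₀ + μ • (A₀ ⨯₃ A₁) := by rw [← e01]; simp
    rw [hδ, e, e', add_dotProduct, add_dotProduct, h00, smul_dotProduct, smul_dotProduct,
      dotProduct_comm _ A₀, dot_self_cross, dotProduct_comm _ A₀]
    simp
  have hγ' : γ = 1 - μ * (A₀ ⬝ᵥ A₁ ⨯₃ A₂) := by
    have e : b₀ = b₁ - μ • (A₀ ⨯₃ A₁) := by rw [← e01]; simp
    rw [hγ, e, sub_dotProduct, h12, smul_dotProduct, dotProduct_comm _ A₂,
      triple_product_permutation A₂, smul_eq_mul]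
  -- the points `B i`, `B (i + 1)`, `D`, `C` in homogeneous coordinates
  have c0 : b₀ ⨯₃ b₁ = μ • (A₀ - A₁) := by
    have e' : b₁ = b₀ + μ • (A₀ ⨯₃ A₁) := by rw [← e01]; simp
    rw [e', map_add, cross_self, map_smul, cross_cross_eq_smul_sub_smul', h01, dotProduct_comm A₀,
      h00]
    simp
  have c1 : b₁ ⨯₃ b₂ = (-ν) • (A₂ - A₁) := by
    have e' : b₂ = b₁ + ν • (A₁ ⨯₃ A₂) := by rw [← e12]; simp
    rw [e', map_add, cross_self, map_smul, cross_cross_eq_smul_sub_smul', h12, dotProduct_comm A₁,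
      h11]
    simp only [one_smul, zero_add]
    module
  have cD : (A₀ ⨯₃ A₁) ⨯₃ b₂ = δ • A₁ - A₀ := by
    rw [cross_cross_eq_smul_sub_smul, dotProduct_comm A₀, dotProduct_comm A₁, h21, one_smul]
  have cC : b₀ ⨯₃ (A₁ ⨯₃ A₂) = γ • A₁ - A₂ := by
    rw [cross_cross_eq_smul_sub_smul', dotProduct_comm A₁, h01, one_smul]
  have nD : δ • A₁ - A₀ ≠ 0 := by
    intro h
    have := (LinearIndependent.pair_iff.1 i10 δ (-1) (by rw [← h]; module)).2
    norm_num at this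
  have nC : γ • A₁ - A₂ ≠ 0 := by
    intro h
    have := (LinearIndependent.pair_iff.1 i12 γ (-1) (by rw [← h]; module)).2
    norm_num at this
  have rB0 : IsRep (A₀ - A₁) (P.B i) := by
    have h1 := hb₀.cross hb₁ (by rw [c0]; exact smul_ne_zero hμ (sub_ne_zero.2 n0))
    rw [c0] at h1
    have h2 := h1.smul (inv_ne_zero hμ)
    rwa [smul_smul, inv_mul_cancel₀ hμ, one_smul] at h2
  have rB1 : IsRep (A₂ - A₁) (P.B (i + 1)) := by
    rw [← hi] at hb₂
    have h1 := hb₁.cross hb₂ (by rw [c1]; exact smul_ne_zero (neg_ne_zero.2 hν) (sub_ne_zero.2 n2))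
    rw [c1] at h1
    have h2 := h1.smul (inv_ne_zero (neg_ne_zero.2 hν))
    rwa [smul_smul, inv_mul_cancel₀ (neg_ne_zero.2 hν), one_smul] at h2
  have rD : IsRep (δ • A₁ - A₀) (meet (P.a i) (P.b (i + 2))) := by
    have h1 := (hA₀.cross hA₁ l10).cross hb₂ (by rw [cD]; exact nD)
    rwa [cD] at h1
  have rC : IsRep (γ • A₁ - A₂) (meet (P.b i) (P.a (i + 1))) := by
    have hA₂' := hA₂
    rw [← hi] at hA₂'
    have h1 := hb₀.cross (hA₁.cross hA₂' l12) (by rw [cC]; exact nC)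
    rwa [cC] at h1
  constructor
  · rintro ⟨r, s, hr, hs, hrs⟩
    rw [hr.eq_one_sub hA₁ rB0 hA₀ rD, hs.eq_one_sub hA₁ rB1 hA₂ rC, hδ', hγ'] at hrs
    apply mul_right_cancel₀ hD
    linarith
  · rintro rfl
    refine ⟨_, _, hasCrossRatio_one_sub i10 hA₁ rB0 hA₀ rD,
      hasCrossRatio_one_sub i12 hA₁ rB1 hA₂ rC, ?_⟩
    rw [hδ', hγ']
    ring

/-! ### Dancing pairs and horizontal polygons -/

/-- A closed polygon in `Qdan` is horizontal and non-degenerate exactly if consecutive vertices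
satisfy the edge equation and consecutive triples of points are independent. -/
theorem isHorizontalPolygon_iff {n : ℕ} (R : ZMod n → Qdan) : IsHorizontalPolygon R ↔
    (∀ i, (R (i + 1)).1.2 - (R i).1.2 = (R i).1.1 ⨯₃ (R (i + 1)).1.1) ∧
    ∀ i, (R i).1.1 ⬝ᵥ (R (i + 1)).1.1 ⨯₃ (R (i + 2)).1.1 ≠ 0 := by
  have hi (i : ZMod n) : i + 1 + 1 = i + 2 := by rw [add_assoc, one_add_one_eq_two]
  have hcol (hE : ∀ i, (R (i + 1)).1.2 - (R i).1.2 = (R i).1.1 ⨯₃ (R (i + 1)).1.1) (i : ZMod n)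
      (hne : (R i).1.1 ≠ (R (i + 1)).1.1) :
      Collinear ℝ {(R i).1, (R (i + 1)).1, (R (i + 2)).1} ↔
        (R i).1.1 ⬝ᵥ (R (i + 1)).1.1 ⨯₃ (R (i + 2)).1.1 = 0 := by
    have e1 := hE (i + 1)
    rw [hi] at e1
    have k := dot_eq_one_of_edge (R (i + 2)).2 e1
    have k0 := succ_dot_eq_one_of_edge (R i).2 (hE i)
    exact collinear_iff_triple_eq_zero (R (i + 1)).2 k0 k (hE i) e1 hne
  constructor
  · rintro ⟨h1, h2⟩
    have hE := fun i => ((isHorizontalLine_iff (R i).2 (R (i + 1)).2).1 (h1 i)).2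
    refine ⟨hE, fun i h => h2 i ((hcol hE i fun e => (h1 i).1 ?_).2 h)⟩
    have h3 := hE i
    rw [e, cross_self, sub_eq_zero] at h3
    exact Prod.ext e h3.symm
  · rintro ⟨hE, hD⟩
    have hne (i) : (R i).1.1 ≠ (R (i + 1)).1.1 := by
      intro e
      apply hD i
      rw [e, dot_self_cross]
    exact ⟨fun i => (isHorizontalLine_iff (R i).2 (R (i + 1)).2).2
      ⟨fun e => hne i (congrArg Prod.fst e), hE i⟩, fun i h => hD i ((hcol hE i (hne i)).1 h)⟩

theorem IsHorizontalPolygon.dot_succ {n : ℕ} {R : ZMod n → Qdan} (hR : IsHorizontalPolygon R)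
    (i : ZMod n) : (R i).1.2 ⬝ᵥ (R (i + 1)).1.1 = 1 :=
  dot_eq_one_of_edge (R (i + 1)).2 (((isHorizontalPolygon_iff R).1 hR).1 i)

theorem IsHorizontalPolygon.succ_dot {n : ℕ} {R : ZMod n → Qdan} (hR : IsHorizontalPolygon R)
    (i : ZMod n) : (R (i + 1)).1.2 ⬝ᵥ (R i).1.1 = 1 :=
  succ_dot_eq_one_of_edge (R i).2 (((isHorizontalPolygon_iff R).1 hR).1 i)

theorem cross_ne_zero_of_triple_left {u v w : Vec3} (h : u ⬝ᵥ v ⨯₃ w ≠ 0) : u ⨯₃ v ≠ 0 := by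
  intro e
  rw [triple_product_permutation, triple_product_permutation, e] at h
  simp at h

/-- A non-degenerate closed horizontal polygon projects to a non-degenerate dancing pair. -/
theorem IsHorizontalPolygon.exists_dancingPair {n : ℕ} {R : ZMod n → Qdan}
    (hR : IsHorizontalPolygon R) : ∃ P : DancingPair n, LiftsPair R P.1 := by
  obtain ⟨hE, hD⟩ := (isHorizontalPolygon_iff R).1 hR
  have hi (i : ZMod n) : i + 1 + 1 = i + 2 := by rw [add_assoc, one_add_one_eq_two]
  have h0 (i) : (R i).1.2 ⬝ᵥ (R i).1.1 = 1 := (R i).2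
  have nA (i) : (R i).1.1 ≠ 0 := fun e => by simpa [e] using h0 i
  have nb (i) : (R i).1.2 ≠ 0 := fun e => by simpa [e] using h0 i
  have hs := hR.dot_succ
  have hp := hR.succ_dot
  have hDb (i) : (R i).1.2 ⬝ᵥ (R (i + 1)).1.2 ⨯₃ (R (i + 2)).1.2 ≠ 0 := by
    have e1 := hE (i + 1)
    rw [hi] at e1
    rw [triple_lines_eq (h0 (i + 1)) (hE i) e1]
    exact hD i
  let P : PolygonPair n :=
    ⟨fun i => Projectivization.mk ℝ (R i).1.1 (nA i), fun i => Projectivization.mk ℝ (R i).1.2 (nb i)⟩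
  have rA (i) : IsRep (R i).1.1 (P.A i) := ⟨nA i, rfl⟩
  have rb (i) : IsRep (R i).1.2 (P.b i) := ⟨nb i, rfl⟩
  refine ⟨⟨P, fun i => ?_, ⟨fun i => ?_, fun i => ?_, fun i => ?_⟩, fun i => ?_⟩,
    fun i => ⟨rA i, rb i⟩⟩
  · have k1 := (rA i).cross (rA (i + 1)) (cross_ne_zero_of_triple_left (hD i))
    have k2 := (rb i).cross (rb (i + 1)) (cross_ne_zero_of_triple_left (hDb i))
    refine (k2.incident_iff k1).2 ?_
    rw [cross_dot_cross, dotProduct_comm, h0, dotProduct_comm, h0, dotProduct_comm, hp,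
      dotProduct_comm, hs]
    norm_num
  · rw [(rA i).incident_iff (rb i), h0]
    exact one_ne_zero
  · exact (independent_iff_triple_ne_zero (rA i) (rA (i + 1)) (rA (i + 2))).2 (hD i)
  · exact (independent_iff_triple_ne_zero (rb i) (rb (i + 1)) (rb (i + 2))).2 (hDb i)
  · have e1 := hE (i + 1)
    have s1 := hs (i + 1)
    have p1 := hp (i + 1)
    rw [hi] at e1 s1 p1
    exact (dancing_iff P i (rA i) (rA (i + 1)) (rA (i + 2)) (rb i) (rb (i + 1)) (rb (i + 2))
      (h0 i) (hs i) (h0 (i + 1)) s1 p1 one_ne_zero one_ne_zero (by rw [hE, one_smul])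
      (by rw [e1, one_smul]) (hD i)).2 rfl

/-- A pair of polygons has at most one horizontal lift: the common scale of two lifts is a real
cube root of `1`. -/
theorem IsHorizontalPolygon.eq_of_liftsPair {n : ℕ} {R R' : ZMod n → Qdan} {P : PolygonPair n}
    (hR : IsHorizontalPolygon R) (hR' : IsHorizontalPolygon R') (hP : LiftsPair R P)
    (hP' : LiftsPair R' P) : R = R' := by
  obtain ⟨hE, hD⟩ := (isHorizontalPolygon_iff R).1 hR
  obtain ⟨hE', -⟩ := (isHorizontalPolygon_iff R').1 hR'
  have hA (i) : ∃ α : ℝ, α ≠ 0 ∧ (R' i).1.1 = α • (R i).1.1 :=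
    IsRep.exists_smul (hP i).1 (hP' i).1
  have hb (i) : ∃ β : ℝ, β ≠ 0 ∧ (R' i).1.2 = β • (R i).1.2 :=
    IsRep.exists_smul (hP i).2 (hP' i).2
  choose α hα eA using hA
  choose β hβ eb using hb
  have h1 (i) : β i * α i = 1 := by
    have k : (R' i).1.2 ⬝ᵥ (R' i).1.1 = 1 := (R' i).2
    have k' : (R i).1.2 ⬝ᵥ (R i).1.1 = 1 := (R i).2
    rw [eA, eb, smul_dotProduct, dotProduct_smul, k'] at k
    simpa using k
  have h2 (i) : β i * α (i + 1) = 1 := by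
    have k := hR'.dot_succ i
    rw [eA, eb, smul_dotProduct, dotProduct_smul, hR.dot_succ] at k
    simpa using k
  have h3 (i) : α (i + 1) = α i := mul_left_cancel₀ (hβ i) ((h2 i).trans (h1 i).symm)
  have h4 (i) : β (i + 1) = β i := by
    apply mul_right_cancel₀ (hα i)
    rw [h1, ← h3, h1]
  have h5 (i) : β i = α i * α i := by
    have k := hE' i
    rw [eb, eb, eA, eA, h4, h3, ← smul_sub, hE, map_smul, LinearMap.map_smul₂, smul_smul] at k
    have k2 := cross_ne_zero_of_triple_left (hD i)
    exact smul_left_injective ℝ k2 k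
  have h6 (i) : α i = 1 := by
    have k := h1 i
    rw [h5] at k
    have k2 : α i ^ 3 = 1 ^ 3 := by rw [one_pow, ← k]; ring
    exact (Odd.strictMono_pow (by decide : Odd 3)).injective k2
  ext1 i
  have h7 : β i = 1 := by rw [h5, h6, one_mul]
  exact Subtype.ext (Prod.ext (by rw [eA, h6, one_smul]) (by rw [eb, h7, one_smul]))

theorem exists_smul_cross {d u w : Vec3} (hu : d ⬝ᵥ u = 0) (hw : d ⬝ᵥ w = 0)
    (h : u ⨯₃ w ≠ 0) : ∃ μ : ℝ, d = μ • (u ⨯₃ w) := by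
  have h1 : ¬ LinearIndependent ℝ ![u ⨯₃ w, d] := by
    rw [← crossProduct_ne_zero_iff_linearIndependent, not_not, cross_cross_eq_smul_sub_smul,
      dotProduct_comm u, dotProduct_comm w, hu, hw]
    simp
  rw [LinearIndependent.pair_iff' h] at h1
  push Not at h1
  obtain ⟨μ, hμ⟩ := h1
  exact ⟨μ, hμ.symm⟩

theorem exists_pow_three_eq (x : ℝ) : ∃ y : ℝ, y ^ 3 = x := by
  rcases le_total 0 x with h | h
  · exact ⟨x ^ ((3 : ℕ) : ℝ)⁻¹, Real.rpow_inv_natCast_pow h (by norm_num)⟩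
  · refine ⟨-(-x) ^ ((3 : ℕ) : ℝ)⁻¹, ?_⟩
    rw [Odd.neg_pow (by decide), Real.rpow_inv_natCast_pow (neg_nonneg.2 h) (by norm_num), neg_neg]

/-- Every non-degenerate dancing pair lifts to a closed horizontal polygon. Each edge of an
inscribed pair has a horizontal lift, unique up to the choice of a real cube root; the dancing
condition makes the lifts of adjacent edges agree at their common vertex, so that the lift closes
up. -/
theorem exists_lift_of_dancingPair {n : ℕ} (P : DancingPair n) :
    ∃ R : ZMod n → Qdan, IsHorizontalPolygon R ∧ LiftsPair R P.1 := by
  obtain ⟨P, hI, ⟨hN, hNA, hNb⟩, hdance⟩ := P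
  have hi (i : ZMod n) : i + 1 + 1 = i + 2 := by rw [add_assoc, one_add_one_eq_two]
  choose A rA using fun i => exists_isRep (P.A i)
  choose w rl using fun i => exists_isRep (P.b i)
  have hwA (i) : w i ⬝ᵥ A i ≠ 0 := by
    rw [ne_eq, ← (rA i).incident_iff (rl i)]
    exact hN i
  obtain ⟨b, rb, h0⟩ : ∃ b : ZMod n → Vec3, (∀ i, IsRep (b i) (P.b i)) ∧ ∀ i, b i ⬝ᵥ A i = 1 :=
    ⟨fun i => (w i ⬝ᵥ A i)⁻¹ • w i, fun i => (rl i).smul (inv_ne_zero (hwA i)), fun i => by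
      rw [smul_dotProduct, smul_eq_mul, inv_mul_cancel₀ (hwA i)]⟩
  have hDA (i) : A i ⬝ᵥ A (i + 1) ⨯₃ A (i + 2) ≠ 0 :=
    (independent_iff_triple_ne_zero (rA i) (rA (i + 1)) (rA (i + 2))).1 (hNA i)
  have hDb (i) : b i ⬝ᵥ b (i + 1) ⨯₃ b (i + 2) ≠ 0 :=
    (independent_iff_triple_ne_zero (rb i) (rb (i + 1)) (rb (i + 2))).1 (hNb i)
  have cA (i) := cross_ne_zero_of_triple_left (hDA i)
  have cb (i) := cross_ne_zero_of_triple_left (hDb i)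
  -- inscription, as an equation between pairings
  set c : ZMod n → ℝ := fun i => b i ⬝ᵥ A (i + 1) with hc
  have hc1 (i) : c i * (b (i + 1) ⬝ᵥ A i) = 1 := by
    have k := (((rb i).cross (rb (i + 1)) (cb i)).incident_iff
      ((rA i).cross (rA (i + 1)) (cA i))).1 (hI i)
    rw [cross_dot_cross, dotProduct_comm (A i) (b i), h0, dotProduct_comm (A (i + 1)), h0,
      dotProduct_comm (A i), dotProduct_comm (A (i + 1))] at k
    linarith
  have hc0 (i) : c i ≠ 0 := left_ne_zero_of_mul_eq_one (hc1 i)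
  have hμ (i) : ∃ μ : ℝ, c i • b (i + 1) - b i = μ • (A i ⨯₃ A (i + 1)) := by
    refine exists_smul_cross ?_ ?_ (cA i)
    · rw [sub_dotProduct, smul_dotProduct, smul_eq_mul, hc1, h0, sub_self]
    · rw [sub_dotProduct, smul_dotProduct, h0, smul_eq_mul, mul_one, sub_self]
  choose μ eμ using hμ
  have hμ0 (i) : μ i ≠ 0 := by
    intro h
    have k := eμ i
    rw [h, zero_smul, sub_eq_zero] at k
    apply cb i
    rw [← k, LinearMap.map_smul₂, cross_self, smul_zero]
  have hrec (i) : μ i * c i = c i ^ 3 * (μ (i + 1) * c (i + 1)) := by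
    have e1 := eμ (i + 1)
    have d1 := hc1 (i + 1)
    have f1 : b (i + 1) ⬝ᵥ A (i + 1 + 1) = c (i + 1) := rfl
    rw [hi] at e1 d1 f1
    have hc1' := hc0 (i + 1)
    have hci := hc0 i
    refine (dancing_iff P i (A₁ := (c i)⁻¹ • A (i + 1))
      (A₂ := ((c i)⁻¹ * (c (i + 1))⁻¹) • A (i + 2)) (b₁ := c i • b (i + 1))
      (b₂ := (c i * c (i + 1)) • b (i + 2)) (rA i) ((rA (i + 1)).smul (inv_ne_zero hci))
      ((rA (i + 2)).smul (mul_ne_zero (inv_ne_zero hci) (inv_ne_zero hc1'))) (rb i)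
      ((rb (i + 1)).smul hci) ((rb (i + 2)).smul (mul_ne_zero hci hc1')) (h0 i) ?_ ?_ ?_ ?_
      (mul_ne_zero (hμ0 i) hci) (mul_ne_zero (pow_ne_zero 3 hci)
        (mul_ne_zero (hμ0 (i + 1)) hc1')) ?_ ?_ ?_).1 (hdance i)
    · rw [dotProduct_smul, smul_eq_mul]
      exact inv_mul_cancel₀ hci
    · rw [dotProduct_smul, smul_dotProduct, h0, smul_eq_mul, smul_eq_mul, mul_one]
      exact inv_mul_cancel₀ hci
    · rw [dotProduct_smul, smul_dotProduct, f1, smul_eq_mul, smul_eq_mul]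
      field_simp
    · rw [dotProduct_smul, smul_dotProduct, smul_eq_mul, smul_eq_mul]
      calc _ = (c i)⁻¹ * c i * (c (i + 1) * (b (i + 2) ⬝ᵥ A (i + 1))) := by ring
        _ = 1 := by rw [d1, inv_mul_cancel₀ hci, one_mul]
    · rw [eμ, map_smul, smul_smul, mul_assoc, mul_inv_cancel₀ hci, mul_one]
    · rw [mul_smul, ← smul_sub, e1, map_smul, LinearMap.map_smul₂, smul_smul, smul_smul, smul_smul]
      congr 1
      field_simp
    · have k := triple_smul 1 (c i)⁻¹ ((c i)⁻¹ * (c (i + 1))⁻¹) (A i) (A (i + 1)) (A (i + 2))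
      rw [one_smul] at k
      rw [k]
      have := hDA i
      positivity
  choose t ht using fun i => exists_pow_three_eq (μ i * c i)
  have ht0 (i) : t i ≠ 0 := by
    intro h
    have k := ht i
    rw [h] at k
    exact mul_ne_zero (hμ0 i) (hc0 i) (by rw [← k]; norm_num)
  have htrec (i) : t i = c i * t (i + 1) := by
    apply (Odd.strictMono_pow (by decide : Odd 3)).injective
    simp only
    rw [mul_pow, ht, ht, hrec]
  let R : ZMod n → Qdan := fun i => ⟨(t i • A i, (t i)⁻¹ • b i), by
    change ((t i)⁻¹ • b i) ⬝ᵥ (t i • A i) = 1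
    rw [dotProduct_smul, smul_dotProduct, h0, smul_eq_mul, smul_eq_mul, mul_one,
      mul_inv_cancel₀ (ht0 i)]⟩
  refine ⟨R, (isHorizontalPolygon_iff R).2 ⟨fun i => ?_, fun i => ?_⟩,
    fun i => ⟨(rA i).smul (ht0 i), (rb i).smul (inv_ne_zero (ht0 i))⟩⟩
  · change (t (i + 1))⁻¹ • b (i + 1) - (t i)⁻¹ • b i = (t i • A i) ⨯₃ (t (i + 1) • A (i + 1))
    have k1 : (t (i + 1))⁻¹ = (t i)⁻¹ * c i := by
      rw [htrec i]
      have := ht0 (i + 1)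
      have := hc0 i
      field_simp
    have k2 : (t i)⁻¹ * μ i = t (i + 1) * t i := by
      have h3 := ht i
      have := ht0 i
      have hci := hc0 i
      rw [inv_mul_eq_iff_eq_mul₀ this]
      apply mul_right_cancel₀ hci
      rw [← h3]
      calc t i ^ 3 = t i * t i * t i := by ring
        _ = t i * t i * (c i * t (i + 1)) := by rw [← htrec]
        _ = _ := by ring
    rw [k1, mul_smul, ← smul_sub, eμ, map_smul, LinearMap.map_smul₂, smul_smul, smul_smul, k2]
  · change (t i • A i) ⬝ᵥ (t (i + 1) • A (i + 1)) ⨯₃ (t (i + 2) • A (i + 2)) ≠ 0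
    rw [triple_smul]
    exact mul_ne_zero (mul_ne_zero (mul_ne_zero (ht0 i) (ht0 _)) (ht0 _)) (hDA i)

/-! ### Horizontal lifts and monodromy of spherical polygons -/

/-- The element of `S³` by which rolling along a great circle from `v` to `w` multiplies the lifted
orientation, for `ρ = 3`. -/
noncomputable def rollStep (v w : S2) : S3 :=
  ⟨(imQ w.1 * imQ v.1) ^ 2, by
    have h (u : S2) : ‖imQ u.1‖ = 1 := by
      apply norm_eq_one_of_star_mul_self
      rw [star_imQ, neg_mul, imQ_mul_self, u.2]
      simp
    simp [h]⟩

theorem rollStep_eq_of_eq_or_neg {v v' w w' : S2} (h : v'.1 = v.1 ∨ v'.1 = -v.1)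
    (h' : w'.1 = w.1 ∨ w'.1 = -w.1) : rollStep v' w' = rollStep v w := by
  apply Subtype.ext
  rcases h with h | h <;> rcases h' with h' | h' <;> simp [rollStep, h, h', imQ_neg]

namespace SphericalPolygon

variable {n : ℕ} (Γ : SphericalPolygon n)

theorem rollsTo_iff_eq_mul (i : ZMod n) (q q' : S3) :
    Γ.RollsTo 3 i q q' ↔ q' = rollStep (Γ.v i) (Γ.v (i + 1)) * q := by
  rw [rollsTo_iff, Subtype.ext_iff]
  rfl

/-- The product of the first `k` rolling steps along the polygon. -/
noncomputable def transport : ℕ → S3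
  | 0 => 1
  | k + 1 => rollStep (Γ.v (k : ZMod n)) (Γ.v ((k : ZMod n) + 1)) * transport k

theorem isHorizontalLift_iff (q : S3) (Q : ℕ → S3) :
    Γ.IsHorizontalLift 3 q Q ↔ ∀ k, Q k = Γ.transport k * q := by
  constructor
  · rintro ⟨h0, h1⟩ k
    induction k with
    | zero => rw [h0, transport, one_mul]
    | succ k ih => rw [(Γ.rollsTo_iff_eq_mul _ _ _).1 (h1 k), ih, transport, mul_assoc]
  · intro h
    refine ⟨by rw [h, transport, one_mul], fun k => ?_⟩
    rw [rollsTo_iff_eq_mul, h, h, transport, mul_assoc]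

theorem trivialLiftedMonodromy_iff : Γ.TrivialLiftedMonodromy 3 ↔ Γ.transport n = 1 := by
  constructor
  · rintro ⟨Q, hQ, h⟩
    rw [← h, (Γ.isHorizontalLift_iff 1 Q).1 hQ n, mul_one]
  · intro h
    exact ⟨Γ.transport, (Γ.isHorizontalLift_iff _ _).2 fun k => (mul_one _).symm, h⟩

theorem isGeneric_iff (q : S3) : IsGeneric Γ q ↔
    ∀ k < n, phi (Γ.v (k : ZMod n)) (Γ.transport k * q) ∈ Set.range iota := by
  constructor
  · rintro ⟨Q, hQ, h⟩ k hk
    rw [← (Γ.isHorizontalLift_iff q Q).1 hQ]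
    exact h k hk
  · intro h
    exact ⟨_, (Γ.isHorizontalLift_iff q _).2 fun k => rfl, h⟩

theorem transport_eq_of_eq_or_neg {Γ Γ' : SphericalPolygon n}
    (h : ∀ i, (Γ'.v i).1 = (Γ.v i).1 ∨ (Γ'.v i).1 = -(Γ.v i).1) (k : ℕ) :
    Γ'.transport k = Γ.transport k := by
  induction k with
  | zero => rfl
  | succ k ih => rw [transport, transport, ih, rollStep_eq_of_eq_or_neg (h _) (h _)]

/-- With trivial monodromy, the lifted orientation at a vertex depends only on the vertex. -/
theorem transport_val [NeZero n] (h : Γ.transport n = 1) (k : ℕ) :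
    Γ.transport (k : ZMod n).val = Γ.transport k := by
  have hp (k : ℕ) : Γ.transport (k + n) = Γ.transport k := by
    induction k with
    | zero => rw [zero_add, h, transport]
    | succ k ih =>
      rw [add_right_comm, transport, transport, ih]
      simp
  have hp' (m k : ℕ) : Γ.transport (k + n * m) = Γ.transport k := by
    induction m with
    | zero => rw [mul_zero, add_zero]
    | succ m ih => rw [mul_add, mul_one, ← add_assoc, hp, ih]
  rw [ZMod.val_natCast]
  conv_rhs => rw [← Nat.mod_add_div k n]
  rw [hp']

/-- Consecutive points of the sphere that are independent can be joined by arcs of great circles. -/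
theorem exists_of_vertices (v : ZMod n → S2) (h : ∀ i, (v i).1 ⨯₃ (v (i + 1)).1 ≠ 0) :
    ∃ Γ : SphericalPolygon n, Γ.v = v := by
  set c : ZMod n → ℝ := fun i => (v i).1 ⬝ᵥ (v (i + 1)).1 with hc
  have hpos (i) : 0 < 1 - c i ^ 2 := by
    have e : (v i).1 ⨯₃ (v (i + 1)).1 ⬝ᵥ (v i).1 ⨯₃ (v (i + 1)).1 = 1 - c i ^ 2 := by
      rw [cross_dot_cross, (v i).2, (v (i + 1)).2, dotProduct_comm (v (i + 1)).1 (v i).1, hc]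
      ring
    rw [← e]
    exact lt_of_le_of_ne (Finset.sum_nonneg fun j _ => mul_self_nonneg _)
      (fun k => h i (dotProduct_self_eq_zero.1 k.symm))
  have h1 (i) : c i < 1 := by nlinarith [hpos i]
  have h2 (i) : -1 < c i := by nlinarith [hpos i]
  set s : ZMod n → ℝ := fun i => Real.sqrt (1 - c i ^ 2) with hs
  have hs0 (i) : s i ≠ 0 := (Real.sqrt_pos.2 (hpos i)).ne'
  have hs2 (i) : s i * s i = 1 - c i ^ 2 := Real.mul_self_sqrt (hpos i).le
  have hvv (i) : (v i).1 ⬝ᵥ (v i).1 = 1 := (v i).2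
  have hd (i) : ((s i)⁻¹ • ((v (i + 1)).1 - c i • (v i).1)) ⬝ᵥ
      ((s i)⁻¹ • ((v (i + 1)).1 - c i • (v i).1)) = 1 := by
    have e : (v (i + 1)).1 ⬝ᵥ (v i).1 = c i := dotProduct_comm _ _
    have e' : (v i).1 ⬝ᵥ (v (i + 1)).1 = c i := rfl
    simp only [smul_dotProduct, dotProduct_smul, sub_dotProduct, dotProduct_sub, hvv, e, e',
      smul_eq_mul]
    have := hs0 i
    field_simp
    linear_combination -(hs2 i)
  refine ⟨⟨v, fun i => ⟨_, hd i⟩, fun i => Real.arccos (c i), fun i => ?_,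
    fun i => Real.arccos_pos.2 (h1 i), fun i => ?_⟩, rfl⟩
  · simp only [dotProduct_smul, dotProduct_sub, hvv]
    simp [hc]
  · simp only
    rw [Real.cos_arccos (h2 i).le (h1 i).le, Real.sin_arccos, smul_smul,
      show Real.sqrt (1 - c i ^ 2) * (s i)⁻¹ = 1 from mul_inv_cancel₀ (hs0 i)]
    module

end SphericalPolygon

/-! ### The correspondence -/

/-- For matching vertices, the two notions of non-degeneracy agree. -/
theorem triple_ne_zero_iff {R₀ R₁ R₂ : Qdan} {v₀ v₁ v₂ : S2} {q₀ q₁ q₂ : S3}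
    (h₀ : iota R₀ = phi v₀ q₀) (h₁ : iota R₁ = phi v₁ q₁) (h₂ : iota R₂ = phi v₂ q₂)
    (h01 : R₁.1.2 - R₀.1.2 = R₀.1.1 ⨯₃ R₁.1.1) (h12 : R₂.1.2 - R₁.1.2 = R₁.1.1 ⨯₃ R₂.1.1) :
    v₀.1 ⬝ᵥ v₁.1 ⨯₃ v₂.1 ≠ 0 ↔ R₀.1.1 ⬝ᵥ R₁.1.1 ⨯₃ R₂.1.1 ≠ 0 := by
  obtain ⟨s₀, hs₀, e₀, -⟩ := (iota_eq_phi_iff _ _ _).1 h₀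
  obtain ⟨s₁, hs₁, e₁, -⟩ := (iota_eq_phi_iff _ _ _).1 h₁
  obtain ⟨s₂, hs₂, e₂, -⟩ := (iota_eq_phi_iff _ _ _).1 h₂
  have k0 := succ_dot_eq_one_of_edge R₀.2 h01
  have k := triple_sum_eq R₁.2 k0 (dot_eq_one_of_edge R₂.2 h12) h01 h12
  have hpos := halfSum_dot_self_pos R₁
  rw [halfSum, smul_dotProduct, dotProduct_smul, smul_eq_mul, smul_eq_mul] at hpos
  have hne : (R₁.1.1 + R₁.1.2) ⬝ᵥ (R₁.1.1 + R₁.1.2) ≠ 0 := by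
    intro h
    rw [h] at hpos
    simp at hpos
  rw [e₀, e₁, e₂, halfSum, halfSum, halfSum, smul_smul, smul_smul, smul_smul, triple_smul, k]
  simp only [ne_eq, mul_eq_zero, hs₀, hs₁, hs₂, hne, false_or, one_div, inv_eq_zero,
    OfNat.ofNat_ne_zero]

/-- The vertices in `S² × S³` that match a horizontal polygon in `Qdan` are those of a horizontal
lift. -/
theorem IsHorizontalPolygon.isHorizontalLift {n : ℕ} {R : ZMod n → Qdan}
    (hR : IsHorizontalPolygon R) {Γ : SphericalPolygon n} {Q : ZMod n → S3}
    (h : ∀ i, iota (R i) = phi (Γ.v i) (Q i)) : Γ.IsHorizontalLift 3 (Q 0) fun k => Q k := by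
  refine ⟨by simp only [Nat.cast_zero], fun k => ?_⟩
  simp only [Nat.cast_add, Nat.cast_one]
  rw [Γ.rollsTo_iff]
  exact (edge_iff_rolling (h _) (h _)).1 (((isHorizontalPolygon_iff R).1 hR).1 _)

/-- The lifted polygon may be indexed cyclically: rolling along the edges is then implied by
horizontality in `Qdan`. -/
theorem corresponds_iff {n : ℕ} [NeZero n] (P : PolygonPair n) (Γ : SphericalPolygon n) (q : S3) :
    Corresponds P Γ q ↔ ∃ (R : ZMod n → Qdan) (Q : ZMod n → S3), IsHorizontalPolygon R ∧
      LiftsPair R P ∧ Q 0 = q ∧ ∀ i, iota (R i) = phi (Γ.v i) (Q i) := by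
  constructor
  · rintro ⟨R, Q, hR, hP, ⟨hQ, -⟩, h⟩
    refine ⟨R, fun i => Q i.val, hR, hP, by simp only [ZMod.val_zero, hQ], fun i => ?_⟩
    have k := h i.val (ZMod.val_lt i)
    rwa [ZMod.natCast_zmod_val] at k
  · rintro ⟨R, Q, hR, hP, rfl, h⟩
    exact ⟨R, fun k => Q k, hR, hP, hR.isHorizontalLift h, fun k _ => h k⟩

/-- Corresponding pairs have trivial monodromy and are generic. -/
theorem Corresponds.trivial_and_generic {n : ℕ} [NeZero n] {P : PolygonPair n}
    {Γ : SphericalPolygon n} {q : S3} (h : Corresponds P Γ q) :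
    Γ.TrivialLiftedMonodromy 3 ∧ IsGeneric Γ q := by
  obtain ⟨R, Q, hR, -, rfl, hQ⟩ := (corresponds_iff P Γ q).1 h
  have hl := hR.isHorizontalLift hQ
  refine ⟨Γ.trivialLiftedMonodromy_iff.2 ?_, _, hl, fun k _ => ⟨_, hQ k⟩⟩
  have k := (Γ.isHorizontalLift_iff _ _).1 hl n
  simp only [ZMod.natCast_self] at k
  exact mul_right_cancel (k.symm.trans (one_mul _).symm)

/-- Replacing vertices by their antipodes does not affect the correspondence. -/
theorem Corresponds.congr {n : ℕ} [NeZero n] {P : PolygonPair n} {Γ Γ' : NDSphericalPolygon n}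
    {q : S3} (h : Corresponds P Γ.1 q) (e : Γ ≈ Γ') : Corresponds P Γ'.1 q := by
  rw [corresponds_iff] at h ⊢
  obtain ⟨R, Q, hR, hP, hQ, h⟩ := h
  exact ⟨R, Q, hR, hP, hQ, fun i => (h i).trans (phi_eq_of_eq_or_neg (e i) _).symm⟩

/-- A dancing pair determines `q` and the class of `Γ`. -/
theorem Corresponds.equiv {n : ℕ} [NeZero n] {P : PolygonPair n} {Γ Γ' : NDSphericalPolygon n}
    {q q' : S3} (h : Corresponds P Γ.1 q) (h' : Corresponds P Γ'.1 q') : Γ ≈ Γ' ∧ q = q' := by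
  obtain ⟨R, Q, hR, hP, rfl, hQ⟩ := (corresponds_iff _ _ _).1 h
  obtain ⟨R', Q', hR', hP', rfl, hQ'⟩ := (corresponds_iff _ _ _).1 h'
  obtain rfl := hR.eq_of_liftsPair hR' hP hP'
  exact ⟨fun i => (eq_or_neg_of_iota_eq (hQ i) (hQ' i)).2,
    (eq_or_neg_of_iota_eq (hQ 0) (hQ' 0)).1⟩

/-- `(Γ, q)` determines the dancing pair. -/
theorem Corresponds.pair_eq {n : ℕ} [NeZero n] {P P' : PolygonPair n} {Γ : SphericalPolygon n}
    {q : S3} (h : Corresponds P Γ q) (h' : Corresponds P' Γ q) : P = P' := by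
  obtain ⟨R, Q, hR, hP, hQ, h⟩ := h
  obtain ⟨R', Q', hR', hP', hQ', h'⟩ := h'
  have e : R = R' := by
    ext1 i
    apply iota_injective
    have k := h i.val (ZMod.val_lt i)
    have k' := h' i.val (ZMod.val_lt i)
    rw [(Γ.isHorizontalLift_iff q Q).1 hQ] at k
    rw [(Γ.isHorizontalLift_iff q Q').1 hQ', ← k] at k'
    rw [ZMod.natCast_zmod_val] at k'
    exact k'.symm
  subst e
  have hA : P.A = P'.A := funext fun i => IsRep.eq (hP i).1 (hP' i).1
  have hb : P.b = P'.b := funext fun i => IsRep.eq (hP i).2 (hP' i).2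
  cases P
  cases P'
  simp_all

theorem exists_corresponds_of_dancingPair {n : ℕ} [NeZero n] (P : DancingPair n) :
    ∃ (Γ : NDSphericalPolygon n) (q : S3), Corresponds P.1 Γ.1 q := by
  obtain ⟨R, hR, hP⟩ := exists_lift_of_dancingPair P
  obtain ⟨hE, hD⟩ := (isHorizontalPolygon_iff R).1 hR
  choose v Q h using fun i => exists_iota_eq_phi (R i)
  have hv (i) : (v i).1 ⬝ᵥ (v (i + 1)).1 ⨯₃ (v (i + 2)).1 ≠ 0 := by
    have e := hE (i + 1)
    rw [add_assoc, one_add_one_eq_two] at e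
    exact (triple_ne_zero_iff (h _) (h _) (h _) (hE i) e).2 (hD i)
  obtain ⟨Γ, rfl⟩ := SphericalPolygon.exists_of_vertices v
    fun i => cross_ne_zero_of_triple_left (hv i)
  exact ⟨⟨Γ, fun i => (linearIndependent_iff_triple_ne_zero _ _ _).2 (hv i)⟩, Q 0,
    (corresponds_iff _ _ _).2 ⟨R, Q, hR, hP, rfl, h⟩⟩

theorem exists_corresponds_of_generic {n : ℕ} [NeZero n] (Γ : NDSphericalPolygon n) (q : S3)
    (hT : Γ.1.TrivialLiftedMonodromy 3) (hG : IsGeneric Γ.1 q) :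
    ∃ P : DancingPair n, Corresponds P.1 Γ.1 q := by
  obtain ⟨Γ, hΓ⟩ := Γ
  rw [Γ.trivialLiftedMonodromy_iff] at hT
  rw [Γ.isGeneric_iff] at hG
  have hR (i : ZMod n) : ∃ R, iota R = phi (Γ.v i) (Γ.transport i.val * q) := by
    have k := hG i.val (ZMod.val_lt i)
    rwa [ZMod.natCast_zmod_val] at k
  choose R h using hR
  have hE (i) : (R (i + 1)).1.2 - (R i).1.2 = (R i).1.1 ⨯₃ (R (i + 1)).1.1 := by
    rw [edge_iff_rolling (h i) (h (i + 1)), ← Γ.rollsTo_iff, Γ.rollsTo_iff_eq_mul]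
    have e : Γ.transport (i + 1).val = Γ.transport (i.val + 1) := by
      rw [← Γ.transport_val hT (i.val + 1), Nat.cast_succ, ZMod.natCast_zmod_val]
    rw [e, SphericalPolygon.transport, ZMod.natCast_zmod_val, mul_assoc]
  have hpoly : IsHorizontalPolygon R := by
    refine (isHorizontalPolygon_iff R).2 ⟨hE, fun i => ?_⟩
    have e := hE (i + 1)
    rw [add_assoc, one_add_one_eq_two] at e
    exact (triple_ne_zero_iff (h _) (h _) (h _) (hE i) e).1
      ((linearIndependent_iff_triple_ne_zero _ _ _).1 (hΓ i))
  obtain ⟨P, hP⟩ := hpoly.exists_dancingPair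
  refine ⟨P, (corresponds_iff _ _ _).2 ⟨R, _, hpoly, hP, ?_, h⟩⟩
  rw [ZMod.val_zero, SphericalPolygon.transport, one_mul]

end Dancing

open Dancing
theorem theorem1p3 (n : ℕ) (hn : 0 < n) :
    (∀ Γ Γ' : NDSphericalPolygon n, Γ ≈ Γ' →
      (Γ.1.TrivialLiftedMonodromy 3 ↔ Γ'.1.TrivialLiftedMonodromy 3) ∧
      ∀ q : S3, IsGeneric Γ.1 q ↔ IsGeneric Γ'.1 q) ∧
    ∃ F : DancingPair n ≃ GenericPair n,
      ∀ (P : DancingPair n) (Γ : NDSphericalPolygon n) (q : S3),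
        (F P).1 = (⟦Γ⟧, q) ↔ Corresponds P.1 Γ.1 q := by
  have : NeZero n := ⟨hn.ne'⟩
  constructor
  · intro Γ Γ' h
    have ht := SphericalPolygon.transport_eq_of_eq_or_neg h
    refine ⟨?_, fun q => ?_⟩
    · rw [Γ.1.trivialLiftedMonodromy_iff, Γ'.1.trivialLiftedMonodromy_iff, ht]
    · rw [Γ.1.isGeneric_iff, Γ'.1.isGeneric_iff]
      simp only [ht, phi_eq_of_eq_or_neg (h _)]
  · have hF (P : DancingPair n) : ∃ g : GenericPair n,
        ∀ (Γ : NDSphericalPolygon n) (q : S3), g.1 = (⟦Γ⟧, q) ↔ Corresponds P.1 Γ.1 q := by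
      obtain ⟨Γ₀, q₀, h₀⟩ := exists_corresponds_of_dancingPair P
      obtain ⟨hT, hG⟩ := h₀.trivial_and_generic
      refine ⟨⟨(⟦Γ₀⟧, q₀), Γ₀, rfl, hT, hG⟩, fun Γ q => ⟨fun h => ?_, fun h => ?_⟩⟩
      · obtain ⟨h1, h2⟩ := Prod.mk.injEq .. ▸ h
        rw [← h2]
        exact h₀.congr (Quotient.exact h1)
      · obtain ⟨h1, h2⟩ := h₀.equiv h
        exact Prod.ext (Quotient.sound h1) h2
    choose F hF using hF
    refine ⟨Equiv.ofBijective F ⟨fun P P' h => ?_, fun g => ?_⟩, hF⟩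
    · obtain ⟨Γ, q, hΓ⟩ := exists_corresponds_of_dancingPair P
      have h' := (hF P Γ q).2 hΓ
      rw [h] at h'
      exact Subtype.ext (hΓ.pair_eq ((hF P' Γ q).1 h'))
    · obtain ⟨Γ, hc, hT, hG⟩ := g.2
      obtain ⟨P, hP⟩ := exists_corresponds_of_generic Γ g.1.2 hT hG
      exact ⟨P, Subtype.ext (((hF P Γ g.1.2).2 hP).trans (by rw [hc]))⟩
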